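/- **Setting.** Let $(G_j)_{j\in\mathbb N}$ be a sequence of finite, weighted, connected, undirected graphs $G_j=(V,E,(c_{xy})_{xy\in E})$ with conductances $c_{xy}>0$, and let $n=n_j=|V|\to\infty$ as $j\to\infty$. Each $G_j$ carries site-weights $\pi=(\pi(x))_{x\in V}$ with $\pi(x)>0$ and $\sum_x\pi(x)=1$. (The dependence on $j$ is omitted from the notation.) For $p\in[1,\infty)$ and $\psi:V\to\mathbb R$ let $\|\psi\|_p=\big(\sum_x\pi(x)|\psi(x)|^p\big)^{1/p}$. *Single particle.* Let $$L f=\sum_{xy\in E}c_{xy}(P_{xy}f-f),$$ where $P_{xy}f(z)=\frac{\pi(x)f(x)+\pi(y)f(y)}{\pi(x)+\pi(y)}$ if $z\in\{x,y\}$ and $P_{xy}f(z)=f(z)$ otherwise. Let $$\mathcal E(\psi)=\sum_{xy\in E}c_{xy}\frac{\pi(x)\pi(y)}{\pi(x)+\pi(y)}(\psi(x)-\psi(y))^2$$ be its Dirichlet form, let $$\mathrm{gap}=\inf\Big\{\tfrac{\sum_x\pi(x)f(x)(-Lf)(x)}{\sum_x\pi(x)f(x)^2}:\ f\ne0,\ \sum_x\pi(x)f(x)=0\Big\}$$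 be its spectral gap, and let $t_{\rm rel}=\mathrm{gap}^{-1}$. *Averaging process.* Let $\Delta$ be the set of probability distributions on $V$. The Averaging process $(\eta_t)_{t\ge0}$ is the Markov process on $\Delta$ with generator $f\mapsto\sum_{xy\in E}c_{xy}\big(f(\eta^{xy})-f(\eta)\big)$ (a bounded operator on $C(\Delta)$). Here $\eta^{xy}(x)=\frac{\pi(x)}{\pi(x)+\pi(y)}(\eta(x)+\eta(y))$, $\eta^{xy}(y)=\frac{\pi(y)}{\pi(x)+\pi(y)}(\eta(x)+\eta(y))$, and $\eta^{xy}(z)=\eta(z)$ for $z\ne x,y$. Write $\mathbb E_\eta$ for expectation when $\eta_0=\eta$. **Assumptions.** 1. (Finite-dimensional geometry.) There are positive sequences $d,t_{\rm Nash},T$ such that, for every $j$ and every $\psi:V\to\mathbb R$, $$\|\psi\|_2^{2(1+2/d)}\le t_{\rm Nash}\big(\mathcal E(\psi)+T^{-1}\|\psi\|_2^2\big)\|\psi\|_1^{4/d},$$ and $d=O(1)$, $t_{\rm Nash}=O(t_{\rm rel})$, $T=\Theta(t_{\rm Nash})$ as $j\to\infty$. 2. (Uniform ellipticity.) There is $c_{\rm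 ell}\in[1,\infty)$ with $\max_x\pi(x)/\min_y\pi(y)\le c_{\rm ell}$ for all $j$. **Proposition (Pre-cutoff).** For every $\delta\in(0,1)$ there is $C>0$, depending only on $\delta$ and on the sequence of graphs and site-weights, such that the following holds for every sequence of natural numbers $k=k_j$ with $k/n^2\to\infty$. Put $$a=2\,\frac{\log(k/n)}{\log k},\qquad T^+=a\,\frac{t_{\rm rel}}2\log k+C\,t_{\rm rel},\qquad T^-=\frac{t_{\rm rel}}2\log k-C\,t_{\rm rel}.$$ Then, for all sufficiently large $j$, $a\in[1,2]$ and $T^\pm\ge0$; and for all $p\in[1,2]$, $$\limsup_{j\to\infty}\sqrt k\,\sup_{\eta\in\Delta}\mathbb E_\eta\Big[\Big\|\frac{\eta_{T^+}}\pi-1\Big\|_p\Big]\le\delta,\qquad \liminf_{j\to\infty}\sqrt k\,\sup_{\eta\in\Delta}\mathbb E_\eta\Big[\Big\|\frac{\eta_{T^-}}\pi-1\Big\|_p\Big]\ge\frac1\delta.$$ -/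

import Mathlib

open Filter Topology MeasureTheory Asymptotics
open scoped ENNReal NNReal CompactlySupported

namespace Averaging

/-- A finite, weighted, connected and undirected graph on the vertex set `V`:
the conductance `c x y` is positive on edges and is set to zero off the edges. -/
structure WeightedGraph (V : Type*) where
  graph : SimpleGraph V
  connected : graph.Connected
  c : V → V → ℝ
  c_symm : ∀ x y, c x y = c y x
  c_pos : ∀ x y, graph.Adj x y → 0 < c x y
  c_zero : ∀ x y, ¬ graph.Adj x y → c x y = 0

/-- Non-degenerate site-weights: a probability on `V` charging every vertex. -/
structure SiteWeights (V : Type*) [Fintype V] where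
  w : V → ℝ
  pos : ∀ x, 0 < w x
  sum_eq_one : ∑ x, w x = 1

theorem WeightedGraph.c_nonneg {V : Type*} (G : WeightedGraph V) (x y : V) : 0 ≤ G.c x y := by
  by_cases h : G.graph.Adj x y
  · exact (G.c_pos x y h).le
  · exact (G.c_zero x y h).ge

noncomputable section

variable {V : Type*} [Fintype V]

/-- The weighted sum `∑_{xy ∈ E} c_{xy} F(x,y)` over unordered edges, for a symmetric `F`
(each edge appears twice in the double sum, hence the factor `1/2`). -/
def WeightedGraph.edgeSum {M : Type*} [AddCommGroup M] [Module ℝ M]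
    (G : WeightedGraph V) (F : V → V → M) : M :=
  (1 / 2 : ℝ) • ∑ x, ∑ y, G.c x y • F x y

/-- The norm of `L^p(V, π)`, for `1 ≤ p < ∞`. -/
def SiteWeights.norm (π : SiteWeights V) (p : ℝ) (ψ : V → ℝ) : ℝ :=
  (∑ x, π.w x * |ψ x| ^ p) ^ (1 / p)

/-! ### The single-particle system -/

open Classical in
/-- Resampling of one particle on the pair `{x, y}`: if it sits at `x` or `y` it is put at `x`
with probability `π(x)/(π(x)+π(y))` and at `y` otherwise. -/
def pairResample (π : SiteWeights V) (x y : V) (f : V → ℝ) : V → ℝ := fun z =>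
  if z = x ∨ z = y then
    π.w x / (π.w x + π.w y) * f x + π.w y / (π.w x + π.w y) * f y
  else f z

/-- The generator of the one-particle Binomial Splitting process. -/
def singleGenerator (G : WeightedGraph V) (π : SiteWeights V) (f : V → ℝ) : V → ℝ := fun z =>
  G.edgeSum fun x y => pairResample π x y f z - f z

/-- The spectral gap of the one-particle system, as the infimum of the Rayleigh quotients. -/
def spectralGap (G : WeightedGraph V) (π : SiteWeights V) : ℝ :=
  sInf {r : ℝ | ∃ f : V → ℝ, f ≠ 0 ∧ ∑ x, π.w x * f x = 0 ∧
    r = (∑ x, π.w x * (f x * -singleGenerator G π f x)) / ∑ x, π.w x * f x ^ 2}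

/-- The relaxation time. -/
def relaxationTime (G : WeightedGraph V) (π : SiteWeights V) : ℝ :=
  (spectralGap G π)⁻¹

/-- The Dirichlet form of the one-particle system. -/
def dirichletForm (G : WeightedGraph V) (π : SiteWeights V) (ψ : V → ℝ) : ℝ :=
  G.edgeSum fun x y => π.w x * π.w y / (π.w x + π.w y) * (ψ x - ψ y) ^ 2

/-- The Nash inequality with constants `d`, `tNash`, `T`. -/
def NashInequality (G : WeightedGraph V) (π : SiteWeights V) (d tNash T : ℝ) : Prop :=
  ∀ ψ : V → ℝ, π.norm 2 ψ ^ (2 * (1 + 2 / d)) ≤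
    tNash * (dirichletForm G π ψ + T⁻¹ * π.norm 2 ψ ^ 2) * π.norm 1 ψ ^ (4 / d)

/-! ### The Averaging process -/

open Classical in
/-- The configuration `η^{xy}` as a function on `V`. -/
def averageFun (π : SiteWeights V) (x y : V) (η : V → ℝ) : V → ℝ := fun z =>
  if z = x then π.w x / (π.w x + π.w y) * (η x + η y)
  else if z = y then π.w y / (π.w x + π.w y) * (η x + η y)
  else η z

theorem averageFun_mem (π : SiteWeights V) (x y : V) {η : V → ℝ} (hη : η ∈ stdSimplex ℝ V) :
    averageFun π x y η ∈ stdSimplex ℝ V := by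
  classical
  have hx := π.pos x
  have hy := π.pos y
  refine ⟨fun z => ?_, ?_⟩
  · have h1 := hη.1 x
    have h2 := hη.1 y
    have h3 := hη.1 z
    unfold averageFun
    split_ifs <;> positivity
  · by_cases hxy : x = y
    · subst hxy
      rw [← hη.2]
      refine Finset.sum_congr rfl fun z _ => ?_
      unfold averageFun
      split_ifs with h
      · subst h
        field_simp
      · rfl
    · have key : ∀ z, averageFun π x y η z = η z
          + (if z = x then π.w x / (π.w x + π.w y) * (η x + η y) - η x else 0)
          + (if z = y then π.w y / (π.w x + π.w y) * (η x + η y) - η y else 0) := by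
        intro z
        unfold averageFun
        by_cases h1 : z = x
        · subst h1
          simp [hxy]
        · by_cases h2 : z = y
          · subst h2
            simp [h1]
          · simp [h1, h2]
      simp only [key, Finset.sum_add_distrib, Finset.sum_ite_eq', Finset.mem_univ, if_true, hη.2]
      field_simp
      ring

/-- The map `η ↦ η^{xy}` on the simplex `Δ` of probability distributions over `V`. -/
def averageMap (π : SiteWeights V) (x y : V) : C(stdSimplex ℝ V, stdSimplex ℝ V) where
  toFun η := ⟨averageFun π x y η.1, averageFun_mem π x y η.2⟩
  continuous_toFun := by
    refine Continuous.subtype_mk (continuous_pi fun z => ?_) _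
    have h : ∀ w, Continuous fun η : stdSimplex ℝ V => η.1 w := fun w =>
      (continuous_apply w).comp continuous_subtype_val
    unfold averageFun
    split_ifs
    · exact continuous_const.mul ((h x).add (h y))
    · exact continuous_const.mul ((h x).add (h y))
    · exact h z

/-- The operator `P_{xy} f (η) = f (η^{xy})` on `C(Δ)`. -/
def averageOp (π : SiteWeights V) (x y : V) :
    C(stdSimplex ℝ V, ℝ) →L[ℝ] C(stdSimplex ℝ V, ℝ) :=
  ContinuousMap.compCLM ℝ ℝ (averageMap π x y)

/-- The generator of the Averaging process, a bounded operator on `C(Δ)`. -/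
def generator (G : WeightedGraph V) (π : SiteWeights V) :
    C(stdSimplex ℝ V, ℝ) →L[ℝ] C(stdSimplex ℝ V, ℝ) :=
  G.edgeSum fun x y => averageOp π x y - 1

/-- The topology of `C(X, ℝ) →L[ℝ] C(X, ℝ)` is that of the operator norm, so that
the exponential below is the one of a Banach algebra. -/
instance isTopologicalRing_clm (X : Type*) [TopologicalSpace X] [CompactSpace X] :
    IsTopologicalRing (C(X, ℝ) →L[ℝ] C(X, ℝ)) :=
  let h : NormedRing (C(X, ℝ) →L[ℝ] C(X, ℝ)) := inferInstance
  inferInstanceAs (@IsTopologicalRing (C(X, ℝ) →L[ℝ] C(X, ℝ))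
    h.toMetricSpace.toPseudoMetricSpace.toUniformSpace.toTopologicalSpace _)

/-- The Markov semigroup `S_t = exp (t L)` of the Averaging process on `C(Δ)`. -/
def semigroup (G : WeightedGraph V) (π : SiteWeights V) (t : ℝ≥0) :
    C(stdSimplex ℝ V, ℝ) →L[ℝ] C(stdSimplex ℝ V, ℝ) :=
  NormedSpace.exp ((t : ℝ) • generator G π)

/-- The positive part of the generator, `∑_{xy ∈ E} c_{xy} P_{xy}`. -/
def jumpOp (G : WeightedGraph V) (π : SiteWeights V) :
    C(stdSimplex ℝ V, ℝ) →L[ℝ] C(stdSimplex ℝ V, ℝ) :=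
  G.edgeSum fun x y => averageOp π x y

theorem jumpOp_apply (G : WeightedGraph V) (π : SiteWeights V) (f : C(stdSimplex ℝ V, ℝ))
    (η : stdSimplex ℝ V) :
    jumpOp G π f η = (1 / 2 : ℝ) * ∑ x, ∑ y, G.c x y * f (averageMap π x y η) := by
  simp [jumpOp, WeightedGraph.edgeSum, averageOp]

theorem pow_apply_nonneg {X : Type*} [TopologicalSpace X] (A : C(X, ℝ) →L[ℝ] C(X, ℝ))
    (hA : ∀ f : C(X, ℝ), (∀ x, 0 ≤ f x) → ∀ x, 0 ≤ A f x) (n : ℕ) :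
    ∀ f : C(X, ℝ), (∀ x, 0 ≤ f x) → ∀ x, 0 ≤ (A ^ n) f x := by
  induction n with
  | zero => intro f hf x; simpa using hf x
  | succ n ih =>
    intro f hf x
    rw [pow_succ, mul_apply_eq_comp]
    exact ih _ (hA f hf) x

theorem smul_jumpOp_nonneg (G : WeightedGraph V) (π : SiteWeights V) (t : ℝ≥0)
    (f : C(stdSimplex ℝ V, ℝ)) (hf : ∀ η, 0 ≤ f η) (η : stdSimplex ℝ V) :
    0 ≤ ((t : ℝ) • jumpOp G π) f η := by
  rw [smul_apply, ContinuousMap.smul_apply, jumpOp_apply, smul_eq_mul]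
  exact mul_nonneg t.2 (mul_nonneg (by norm_num) (Finset.sum_nonneg fun x _ =>
    Finset.sum_nonneg fun y _ => mul_nonneg (G.c_nonneg x y) (hf _)))

theorem generator_eq (G : WeightedGraph V) (π : SiteWeights V) :
    generator G π = jumpOp G π - algebraMap ℝ _ (G.edgeSum fun _ _ => (1 : ℝ)) := by
  ext f η
  simp [generator, jumpOp, WeightedGraph.edgeSum, Algebra.algebraMap_eq_smul_one,
    mul_sub, Finset.sum_sub_distrib,
    ← Finset.sum_mul]
  ring

theorem exp_algebraMap_add {A : Type*} [NormedRing A] [NormedAlgebra ℝ A] [CompleteSpace A]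
    (r : ℝ) (a : A) :
    NormedSpace.exp (algebraMap ℝ A r + a) = Real.exp r • NormedSpace.exp a := by
  let _ : NormedAlgebra ℚ A := NormedAlgebra.restrictScalars ℚ ℝ A
  rw [NormedSpace.exp_add_of_commute (Algebra.commutes _ _), ← NormedSpace.algebraMap_exp_comm,
    ← Real.exp_eq_exp_ℝ, Algebra.smul_def]

theorem semigroup_nonneg (G : WeightedGraph V) (π : SiteWeights V) (t : ℝ≥0)
    (f : C(stdSimplex ℝ V, ℝ)) (hf : ∀ η, 0 ≤ f η) (η : stdSimplex ℝ V) :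
    0 ≤ semigroup G π t f η := by
  set r : ℝ := G.edgeSum fun _ _ => (1 : ℝ) with hr
  have h1 : (t : ℝ) • generator G π = algebraMap ℝ _ (-((t : ℝ) * r)) + (t : ℝ) • jumpOp G π := by
    rw [generator_eq, ← hr, smul_sub, Algebra.algebraMap_eq_smul_one,
      Algebra.algebraMap_eq_smul_one, smul_smul, neg_smul]
    abel
  have h2 : semigroup G π t
      = Real.exp (-((t : ℝ) * r)) • NormedSpace.exp ((t : ℝ) • jumpOp G π) := by
    rw [semigroup, h1]
    exact exp_algebraMap_add (A := C(stdSimplex ℝ V, ℝ) →L[ℝ] C(stdSimplex ℝ V, ℝ)) _ _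
  have h3 := NormedSpace.exp_series_hasSum_exp' (𝕂 := ℝ) ((t : ℝ) • jumpOp G π)
  have h4 := h3.mapL (ContinuousLinearMap.apply ℝ (C(stdSimplex ℝ V, ℝ)) f)
  have h5 := h4.mapL (ContinuousMap.evalCLM ℝ η)
  have h6 : 0 ≤ NormedSpace.exp ((t : ℝ) • jumpOp G π) f η := by
    refine h5.nonneg fun n => ?_
    have := pow_apply_nonneg _ (smul_jumpOp_nonneg G π t) n f hf η
    simp only [ContinuousLinearMap.apply_apply, ContinuousMap.evalCLM_apply,
      smul_apply, ContinuousMap.smul_apply, smul_eq_mul]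
    positivity
  rw [h2]
  simp only [smul_apply, ContinuousMap.smul_apply, smul_eq_mul]
  exact mul_nonneg (Real.exp_pos _).le h6

/-- The positive linear functional `f ↦ (S_t f)(η)`. -/
def semigroupFunctional (G : WeightedGraph V) (π : SiteWeights V) (t : ℝ≥0)
    (η : stdSimplex ℝ V) : C_c(stdSimplex ℝ V, ℝ) →ₚ[ℝ] ℝ :=
  PositiveLinearMap.mk₀
    { toFun := fun f => semigroup G π t f.toContinuousMap η
      map_add' := fun f g => by
        have : (f + g).toContinuousMap = f.toContinuousMap + g.toContinuousMap := rfl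
        rw [this, map_add]; rfl
      map_smul' := fun a f => by
        have : (a • f).toContinuousMap = a • f.toContinuousMap := rfl
        rw [this, map_smul]; rfl }
    (fun f hf => semigroup_nonneg G π t f.toContinuousMap hf η)

/-- The law of `η_t` for the Averaging process started from `η`: the measure on `Δ` which
represents the functional `f ↦ (S_t f)(η)`. -/
def law (G : WeightedGraph V) (π : SiteWeights V) (t : ℝ≥0) (η : stdSimplex ℝ V) :
    Measure (stdSimplex ℝ V) :=
  RealRMK.rieszMeasure (semigroupFunctional G π t η)

theorem integral_law (G : WeightedGraph V) (π : SiteWeights V) (t : ℝ≥0) (η : stdSimplex ℝ V)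
    (f : C(stdSimplex ℝ V, ℝ)) : ∫ ζ, f ζ ∂(law G π t η) = semigroup G π t f η :=
  RealRMK.integral_rieszMeasure (semigroupFunctional G π t η)
    (CompactlySupportedContinuousMap.continuousMapEquiv f)

theorem semigroup_one (G : WeightedGraph V) (π : SiteWeights V) (t : ℝ≥0) :
    semigroup G π t 1 = 1 := by
  have h0 : ((t : ℝ) • generator G π) 1 = 0 := by
    ext η
    simp [generator, WeightedGraph.edgeSum, averageOp]
  have h3 := (NormedSpace.exp_series_hasSum_exp' (𝕂 := ℝ) ((t : ℝ) • generator G π)).mapL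
    (ContinuousLinearMap.apply ℝ (C(stdSimplex ℝ V, ℝ)) 1)
  change ContinuousLinearMap.apply ℝ (C(stdSimplex ℝ V, ℝ)) 1 (NormedSpace.exp _) = 1
  refine h3.unique ?_
  have h4 := hasSum_single (f := fun n : ℕ => ContinuousLinearMap.apply ℝ (C(stdSimplex ℝ V, ℝ)) 1
    (((n.factorial : ℝ)⁻¹) • ((t : ℝ) • generator G π) ^ n)) 0 ?_
  · simpa using h4
  · intro n hn
    obtain ⟨m, rfl⟩ := Nat.exists_eq_succ_of_ne_zero hn
    simp only [ContinuousLinearMap.apply_apply, smul_apply, pow_succ,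
      mul_apply_eq_comp, h0, map_zero, smul_zero]

instance isProbabilityMeasure_law (G : WeightedGraph V) (π : SiteWeights V) (t : ℝ≥0)
    (η : stdSimplex ℝ V) : IsProbabilityMeasure (law G π t η) := by
  have : IsFiniteMeasure (law G π t η) := by unfold law; infer_instance
  have h := integral_law G π t η 1
  rw [semigroup_one] at h
  have h' : (law G π t η).real Set.univ = 1 := by simpa using h
  exact ⟨by rwa [Measure.real, ENNReal.toReal_eq_one_iff] at h'⟩

/-- The expected `L^p` distance to equilibrium `E_η[‖η_t/π - 1‖_p]`. -/
def expectedDist (G : WeightedGraph V) (π : SiteWeights V) (p : ℝ) (t : ℝ≥0)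
    (η : stdSimplex ℝ V) : ℝ≥0∞ :=
  ∫⁻ ζ, ENNReal.ofReal (π.norm p fun x => ζ x / π.w x - 1) ∂(law G π t η)

/-- The worst-case distance `sup_{η ∈ Δ} E_η[‖η_t/π - 1‖_p]`. -/
def worstDist (G : WeightedGraph V) (π : SiteWeights V) (p : ℝ) (t : ℝ≥0) : ℝ≥0∞ :=
  ⨆ η : stdSimplex ℝ V, expectedDist G π p t η

end

/-! ### Assumptions on sequences of graphs and site-weights -/

/-- Finite-dimensional geometries: good Nash inequalities along the sequence. -/
def FiniteDimensional {V : ℕ → Type*} [∀ j, Fintype (V j)]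
    (G : ∀ j, WeightedGraph (V j)) (π : ∀ j, SiteWeights (V j)) : Prop :=
  ∃ d tNash T : ℕ → ℝ,
    (∀ j, 0 < d j ∧ 0 < tNash j ∧ 0 < T j) ∧
    (∀ j, NashInequality (G j) (π j) (d j) (tNash j) (T j)) ∧
    d =O[atTop] (fun _ => (1 : ℝ)) ∧
    tNash =O[atTop] (fun j => relaxationTime (G j) (π j)) ∧
    T =Θ[atTop] tNash

/-- Uniformly elliptic site-weights. -/
def UniformlyElliptic {V : ℕ → Type*} [∀ j, Fintype (V j)]
    (π : ∀ j, SiteWeights (V j)) : Prop :=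
  ∃ cEll : ℝ, 1 ≤ cEll ∧ ∀ j, (⨆ x, (π j).w x) / (⨅ y, (π j).w y) ≤ cEll

/-- The factor `a = 2 log(k/n) / log k`. -/
noncomputable def preCutoffFactor (n k : ℕ) : ℝ :=
  2 * (Real.log ((k : ℝ) / n) / Real.log k)

/-- `T⁺ = a (t_rel/2) log k + C t_rel`. -/
noncomputable def timePlus (tRel C : ℝ) (n k : ℕ) : ℝ :=
  preCutoffFactor n k * (tRel / 2) * Real.log k + C * tRel

/-- `T⁻ = (t_rel/2) log k - C t_rel`. -/
noncomputable def timeMinus (tRel C : ℝ) (k : ℕ) : ℝ :=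
  tRel / 2 * Real.log k - C * tRel

end Averaging

/-! Write `ψ_t = η_t/π - 1`, `g` for the spectral gap and `v(t) = E‖ψ_t‖₂²`. In mean, `ψ_t` follows
the heat flow `e^{tL}`, so the mean contributes `e^{-2gt}` to `v`. Each single update is an
orthogonal projection, which dissipates only half as much as the heat flow does; the energy identity
therefore gives just `v(t) ≤ e^{-gt} v(0)`.

The improvement comes from Duhamel's formula along `s ↦ E‖e^{(t-s)L} ψ_s‖²`
(`hasDerivAt_interpolation`): the noise made by an update on `xy` at time `s` points along `edgeVec`
and is then smoothed by `e^{(t-s)L}`. After a time of order `t_rel`, ultracontractivity and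
ellipticity make its weighted size `O(1/n)` times `e^{-2g(t-s)}`, so old noise contributes
`e^{-gt}/n` (`interpolation_le_far`). Noise from the last `ε` units of time is not smoothed, but it
is at most the energy dissipated meanwhile (`interpolation_le_near`). Together they give `v(t) ≤
v(t-ε)/2 + ...`, and iteration over geometrically shrinking `ε` (`iterate_half`) yields `v(t) ≲
e^{-2gt} + e^{-gt}/n` (`evol_sqDist_le`). At `gt = log(k/n) + C` with `n² ≤ k`, both terms are at
most of order `e^{-C}/k`.

Ultracontractivity is Nash's differential inequality, run on `v` itself (`evol_sqDist_le_of_nash`);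
by Jensen `v` dominates the heat flow (`heatNorm_centered_le`). The lower bound tests `ψ_t` against
a gap eigenfunction, started where this is largest (`exp_le_evol_distFun`): the mean alone is
`e^{-gt}`, which is `e^C/√k` at the time `T⁻`. -/

namespace Averaging

noncomputable section

variable {V : Type*} [Fintype V]

/-! ### Algebra of the single-particle system -/

/-- The inner product of `L²(V, π)`. -/
def pairing (π : SiteWeights V) (f g : V → ℝ) : ℝ := ∑ x, π.w x * (f x * g x)

/-- Half the harmonic mean of `π(x)` and `π(y)`. -/
def edgeWeight (π : SiteWeights V) (x y : V) : ℝ := π.w x * π.w y / (π.w x + π.w y)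

open Classical in
/-- The difference `1_x/π(x) - 1_y/π(y)` of two normalized indicators. -/
def edgeVec (π : SiteWeights V) (x y : V) : V → ℝ :=
  Pi.single x (π.w x)⁻¹ - Pi.single y (π.w y)⁻¹

theorem pairing_comm (π : SiteWeights V) (f g : V → ℝ) : pairing π f g = pairing π g f := by
  simp only [pairing, mul_comm (f _)]

theorem pairing_sub_left (π : SiteWeights V) (f g h : V → ℝ) :
    pairing π (f - g) h = pairing π f h - pairing π g h := by
  simp [pairing, sub_mul, mul_sub, Finset.sum_sub_distrib]

theorem pairing_smul_left (π : SiteWeights V) (a : ℝ) (f h : V → ℝ) :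
    pairing π (a • f) h = a * pairing π f h := by
  simp only [pairing, Finset.mul_sum, Pi.smul_apply, smul_eq_mul]
  exact Finset.sum_congr rfl fun x _ => by ring

theorem pairing_self_nonneg (π : SiteWeights V) (f : V → ℝ) : 0 ≤ pairing π f f :=
  Finset.sum_nonneg fun x _ => mul_nonneg (π.pos x).le (mul_self_nonneg _)

theorem eq_zero_of_pairing_self (π : SiteWeights V) {f : V → ℝ} (h : pairing π f f = 0) :
    f = 0 := by
  funext x
  have := (Finset.sum_eq_zero_iff_of_nonneg fun x _ =>
    mul_nonneg (π.pos x).le (mul_self_nonneg (f x))).1 h x (Finset.mem_univ x)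
  simpa [(π.pos x).ne'] using this

theorem pairing_edgeVec (π : SiteWeights V) (x y : V) (g : V → ℝ) :
    pairing π (edgeVec π x y) g = g x - g y := by
  classical
  have h : ∀ z, pairing π (Pi.single z (π.w z)⁻¹) g = g z := fun z => by
    have hz := (π.pos z).ne'
    rw [pairing, Finset.sum_eq_single z]
    · simp [hz]
    · intro b _ hb; simp [hb]
    · simp
  rw [edgeVec, pairing_sub_left]
  convert congrArg₂ (· - ·) (h x) (h y)

theorem edgeWeight_pos (π : SiteWeights V) (x y : V) : 0 < edgeWeight π x y :=
  div_pos (mul_pos (π.pos x) (π.pos y)) (add_pos (π.pos x) (π.pos y))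

theorem edgeWeight_le (π : SiteWeights V) (x y : V) : edgeWeight π x y ≤ π.w x := by
  have hx := π.pos x
  have hy := π.pos y
  rw [edgeWeight, div_le_iff₀ (add_pos hx hy)]
  nlinarith

/-- By this normalization, `f ↦ f - edgeWeight • ⟨edgeVec, f⟩ edgeVec` is the orthogonal projection
onto the functions that agree at `x` and `y`. -/
theorem edgeWeight_mul_pairing_edgeVec (π : SiteWeights V) {x y : V} (hxy : x ≠ y) :
    edgeWeight π x y * pairing π (edgeVec π x y) (edgeVec π x y) = 1 := by
  classical
  have hx := π.pos x
  have hy := π.pos y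
  rw [pairing_edgeVec]
  simp only [edgeVec, edgeWeight, Pi.sub_apply, Pi.single_eq_same, Pi.single_eq_of_ne hxy,
    Pi.single_eq_of_ne hxy.symm]
  field_simp
  ring

theorem edgeVec_self (π : SiteWeights V) (x : V) : edgeVec π x x = 0 := sub_self _

theorem edgeWeight_mul_pairing_edgeVec_le (π : SiteWeights V) (x y : V) :
    edgeWeight π x y * pairing π (edgeVec π x y) (edgeVec π x y) ≤ 1 := by
  by_cases hxy : x = y
  · subst hxy
    simp [edgeVec_self, pairing]
  · exact (edgeWeight_mul_pairing_edgeVec π hxy).le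

theorem sum_weight_mul_edgeVec (π : SiteWeights V) (x y : V) :
    ∑ z, π.w z * edgeVec π x y z = 0 := by
  simpa [pairing] using pairing_edgeVec π x y 1

/-- The rank-one form of an update, on which the later computations rest. It includes `x = y`, where
`edgeVec` vanishes. -/
theorem pairResample_eq (π : SiteWeights V) (x y : V) (f : V → ℝ) :
    pairResample π x y f = f - (edgeWeight π x y * (f x - f y)) • edgeVec π x y := by
  classical
  have hx := π.pos x
  have hy := π.pos y
  funext z
  by_cases hxy : x = y
  · subst hxy
    simp only [pairResample, sub_self, mul_zero, zero_smul, sub_zero, or_self]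
    split_ifs with h
    · subst h
      field_simp
    · rfl
  · by_cases h1 : z = x
    · subst h1
      simp only [pairResample, edgeVec, edgeWeight, Pi.sub_apply, Pi.single_eq_same,
        Pi.single_eq_of_ne hxy, Pi.smul_apply, smul_eq_mul, true_or, if_true]
      field_simp
      ring
    · by_cases h2 : z = y
      · subst h2
        simp only [pairResample, edgeVec, edgeWeight, Pi.sub_apply, Pi.single_eq_same,
          Pi.single_eq_of_ne h1, Pi.smul_apply, smul_eq_mul, or_true, if_true]
        field_simp
        ring
      · simp [pairResample, edgeVec, h1, h2]

theorem pairing_singleGenerator (G : WeightedGraph V) (π : SiteWeights V) (f g : V → ℝ) :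
    pairing π (singleGenerator G π f) g =
      -(1 / 2 * ∑ x, ∑ y, G.c x y * (edgeWeight π x y * ((f x - f y) * (g x - g y)))) := by
  have h : ∀ z, singleGenerator G π f z =
      -(1 / 2 * ∑ x, ∑ y, G.c x y * (edgeWeight π x y * (f x - f y) * edgeVec π x y z)) := by
    intro z
    simp [singleGenerator, WeightedGraph.edgeSum, pairResample_eq, Finset.sum_neg_distrib]
  simp only [pairing, h, ← pairing_edgeVec π _ _ g]
  simp only [Finset.mul_sum, Finset.sum_mul, neg_mul, mul_neg, Finset.sum_neg_distrib]
  congr 1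
  rw [Finset.sum_comm]
  refine Finset.sum_congr rfl fun x _ => ?_
  rw [Finset.sum_comm]
  refine Finset.sum_congr rfl fun y _ => Finset.sum_congr rfl fun z _ => ?_
  ring

theorem pairing_singleGenerator_comm (G : WeightedGraph V) (π : SiteWeights V) (f g : V → ℝ) :
    pairing π (singleGenerator G π f) g = pairing π f (singleGenerator G π g) := by
  rw [pairing_comm π f, pairing_singleGenerator, pairing_singleGenerator]
  simp only [mul_comm (f _ - f _)]

theorem dirichletForm_eq (G : WeightedGraph V) (π : SiteWeights V) (f : V → ℝ) :
    dirichletForm G π f =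
      1 / 2 * ∑ x, ∑ y, G.c x y * (edgeWeight π x y * (f x - f y) ^ 2) := rfl

theorem pairing_singleGenerator_self (G : WeightedGraph V) (π : SiteWeights V) (f : V → ℝ) :
    pairing π (singleGenerator G π f) f = -dirichletForm G π f := by
  simp only [pairing_singleGenerator, dirichletForm_eq, sq]

theorem dirichletForm_nonneg (G : WeightedGraph V) (π : SiteWeights V) (f : V → ℝ) :
    0 ≤ dirichletForm G π f :=
  mul_nonneg (by norm_num) (Finset.sum_nonneg fun x _ => Finset.sum_nonneg fun y _ =>
    mul_nonneg (G.c_nonneg x y) (mul_nonneg (edgeWeight_pos π x y).le (sq_nonneg _)))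

/-- Equality holds across each edge and spreads along walks by connectivity. Hence zero modes are
constants, which are orthogonal to every mean-zero function. -/
theorem eq_of_dirichletForm_eq_zero (G : WeightedGraph V) (π : SiteWeights V) {f : V → ℝ}
    (h : dirichletForm G π f = 0) (x y : V) : f x = f y := by
  have hn : ∀ x y, 0 ≤ G.c x y * (edgeWeight π x y * (f x - f y) ^ 2) := fun x y =>
    mul_nonneg (G.c_nonneg x y) (mul_nonneg (edgeWeight_pos π x y).le (sq_nonneg _))
  rw [dirichletForm_eq, mul_eq_zero] at h
  have h0 := h.resolve_left (by norm_num)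
  have hadj : ∀ x y, G.graph.Adj x y → f x = f y := by
    intro x y hxy
    have h1 := (Finset.sum_eq_zero_iff_of_nonneg
      fun x _ => Finset.sum_nonneg fun y _ => hn x y).1 h0 x (Finset.mem_univ x)
    have h2 := (Finset.sum_eq_zero_iff_of_nonneg fun y _ => hn x y).1 h1 y (Finset.mem_univ y)
    have h3 := (G.c_pos x y hxy).ne'
    have h4 := (edgeWeight_pos π x y).ne'
    simp only [mul_eq_zero, h3, h4, false_or] at h2
    exact sub_eq_zero.1 (pow_eq_zero_iff (two_ne_zero) |>.1 h2)
  obtain ⟨p⟩ := G.connected.preconnected x y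
  induction p with
  | nil => rfl
  | cons h p ih => exact (hadj _ _ h).trans ih

/-- The generator of the single particle as a linear map. -/
def singleGeneratorLin (G : WeightedGraph V) (π : SiteWeights V) : (V → ℝ) →ₗ[ℝ] (V → ℝ) where
  toFun := singleGenerator G π
  map_add' f g := by
    funext z
    simp only [singleGenerator, WeightedGraph.edgeSum, pairResample_eq, Pi.add_apply,
      Pi.sub_apply, Pi.smul_apply, smul_eq_mul, ← mul_add, ← Finset.sum_add_distrib]
    congr 1
    exact Finset.sum_congr rfl fun x _ => Finset.sum_congr rfl fun y _ => by ring
  map_smul' a f := by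
    funext z
    simp only [singleGenerator, WeightedGraph.edgeSum, pairResample_eq, Pi.smul_apply,
      Pi.sub_apply, smul_eq_mul, Finset.mul_sum, RingHom.id_apply]
    exact Finset.sum_congr rfl fun x _ => Finset.sum_congr rfl fun y _ => by ring

/-! ### Spectral decomposition of the single-particle system -/

/-- An orthonormal basis `f` of `L²(V, π)` which diagonalizes the single-particle generator,
with eigenvalues `-l`. -/
structure Diagonalizes (G : WeightedGraph V) (π : SiteWeights V) {ι : Type*} [Fintype ι]
    (l : ι → ℝ) (f : ι → V → ℝ) : Prop where
  eigen : ∀ i, singleGenerator G π (f i) = -l i • f i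
  norm_one : ∀ i, pairing π (f i) (f i) = 1
  parseval : ∀ g h, ∑ i, pairing π g (f i) * pairing π h (f i) = pairing π g h

/-- The generator after the isometry `L²(V, π) → ℓ²(V)`. -/
def conjGenerator (G : WeightedGraph V) (π : SiteWeights V) :
    EuclideanSpace ℝ V →ₗ[ℝ] EuclideanSpace ℝ V where
  toFun φ := WithLp.toLp 2 fun x =>
    √(π.w x) * -singleGeneratorLin G π (fun y => φ y / √(π.w y)) x
  map_add' φ ψ := by
    have : (fun y => (φ + ψ) y / √(π.w y))
        = (fun y => φ y / √(π.w y)) + fun y => ψ y / √(π.w y) := by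
      funext y; simp [add_div]
    ext x
    change √(π.w x) * -singleGeneratorLin G π (fun y => (φ + ψ) y / √(π.w y)) x =
      √(π.w x) * -singleGeneratorLin G π (fun y => φ y / √(π.w y)) x
        + √(π.w x) * -singleGeneratorLin G π (fun y => ψ y / √(π.w y)) x
    rw [this, map_add, Pi.add_apply]
    ring
  map_smul' a φ := by
    have : (fun y => (a • φ) y / √(π.w y)) = a • fun y => φ y / √(π.w y) := by
      funext y; simp [mul_div_assoc]
    ext x
    change √(π.w x) * -singleGeneratorLin G π (fun y => (a • φ) y / √(π.w y)) x =
      a * (√(π.w x) * -singleGeneratorLin G π (fun y => φ y / √(π.w y)) x)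
    rw [this, map_smul, Pi.smul_apply, smul_eq_mul]
    ring

theorem inner_eq_pairing (π : SiteWeights V) (φ ψ : EuclideanSpace ℝ V) :
    inner ℝ φ ψ = pairing π (fun x => φ x / √(π.w x)) fun x => ψ x / √(π.w x) := by
  rw [PiLp.inner_apply, pairing]
  refine Finset.sum_congr rfl fun x _ => ?_
  have h := Real.mul_self_sqrt (π.pos x).le
  have h' := (Real.sqrt_pos.2 (π.pos x)).ne'
  have hπ := (π.pos x).ne'
  rw [div_mul_div_comm, h]
  field_simp
  simp [mul_comm]

theorem conjGenerator_div (G : WeightedGraph V) (π : SiteWeights V) (φ : EuclideanSpace ℝ V) :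
    (fun x => conjGenerator G π φ x / √(π.w x))
      = -singleGenerator G π fun y => φ y / √(π.w y) := by
  funext x
  have h' := (Real.sqrt_pos.2 (π.pos x)).ne'
  simp [conjGenerator, singleGeneratorLin, h', neg_div]

theorem pairing_neg_left (π : SiteWeights V) (f g : V → ℝ) :
    pairing π (-f) g = -pairing π f g := by
  simp [pairing]

theorem isSymmetric_conjGenerator (G : WeightedGraph V) (π : SiteWeights V) :
    (conjGenerator G π).IsSymmetric := by
  intro φ ψ
  rw [inner_eq_pairing π, inner_eq_pairing π, conjGenerator_div, conjGenerator_div,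
    pairing_neg_left, pairing_comm π _ (-_), pairing_neg_left, pairing_comm π (singleGenerator _ _ _),
    pairing_singleGenerator_comm, pairing_comm]

theorem exists_diagonalizes (G : WeightedGraph V) (π : SiteWeights V) :
    ∃ (l : Fin (Fintype.card V) → ℝ) (f : Fin (Fintype.card V) → V → ℝ),
      Diagonalizes G π l f := by
  have hT := isSymmetric_conjGenerator G π
  have hn : Module.finrank ℝ (EuclideanSpace ℝ V) = Fintype.card V := finrank_euclideanSpace
  set b := hT.eigenvectorBasis hn with hb
  have key : ∀ g : V → ℝ, (fun x => (WithLp.toLp 2 fun x => √(π.w x) * g x :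
      EuclideanSpace ℝ V) x / √(π.w x)) = g := by
    intro g
    funext x
    have h' := (Real.sqrt_pos.2 (π.pos x)).ne'
    simp [h']
  refine ⟨hT.eigenvalues hn, fun i x => b i x / √(π.w x), ⟨fun i => ?_, fun i => ?_, ?_⟩⟩
  · have h := conjGenerator_div G π (b i)
    rw [hb, hT.apply_eigenvectorBasis hn i, ← hb] at h
    rw [← neg_inj, ← h]
    funext x
    simp [mul_div_assoc]
  · rw [← inner_eq_pairing]
    simp
  · intro g h
    have := b.sum_inner_mul_inner (WithLp.toLp 2 fun x => √(π.w x) * g x)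
      (WithLp.toLp 2 fun x => √(π.w x) * h x)
    simp only [inner_eq_pairing π, key] at this
    rw [← this]
    exact Finset.sum_congr rfl fun i _ => by rw [pairing_comm π h]

/-- Functions of mean zero. -/
def MeanZero (π : SiteWeights V) (f : V → ℝ) : Prop := ∑ x, π.w x * f x = 0

theorem dirichletForm_const_add (G : WeightedGraph V) (π : SiteWeights V) (f : V → ℝ) (a : ℝ) :
    dirichletForm G π (fun x => f x + a) = dirichletForm G π f := by
  simp [dirichletForm_eq]

theorem spectralGap_eq (G : WeightedGraph V) (π : SiteWeights V) :
    spectralGap G π = sInf {r : ℝ | ∃ f : V → ℝ, f ≠ 0 ∧ MeanZero π f ∧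
      r = dirichletForm G π f / pairing π f f} := by
  have h : ∀ f : V → ℝ, ∑ x, π.w x * (f x * -singleGenerator G π f x)
      = dirichletForm G π f := by
    intro f
    rw [← neg_neg (dirichletForm G π f), ← pairing_singleGenerator_self, pairing_comm]
    simp [pairing]
  simp only [spectralGap, h, MeanZero, pairing, sq]

theorem spectralGap_mul_le (G : WeightedGraph V) (π : SiteWeights V) {f : V → ℝ}
    (hf : MeanZero π f) : spectralGap G π * pairing π f f ≤ dirichletForm G π f := by
  by_cases h0 : f = 0
  · subst h0
    simp [pairing, dirichletForm_eq]
  have hpos : 0 < pairing π f f := lt_of_le_of_ne (pairing_self_nonneg π f)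
    fun h => h0 (eq_zero_of_pairing_self π h.symm)
  rw [← le_div_iff₀ hpos, spectralGap_eq]
  refine csInf_le ⟨0, ?_⟩ ⟨f, h0, hf, rfl⟩
  rintro r ⟨g, -, -, rfl⟩
  exact div_nonneg (dirichletForm_nonneg _ _ _) (pairing_self_nonneg _ _)

namespace Diagonalizes

variable {G : WeightedGraph V} {π : SiteWeights V} {ι : Type*} [Fintype ι]
  {l : ι → ℝ} {f : ι → V → ℝ}

theorem dirichletForm_eigen (h : Diagonalizes G π l f) (i : ι) :
    dirichletForm G π (f i) = l i := by
  have h1 := pairing_singleGenerator_self G π (f i)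
  rw [h.eigen, pairing_smul_left, h.norm_one] at h1
  linarith

theorem eigenvalue_nonneg (h : Diagonalizes G π l f) (i : ι) : 0 ≤ l i :=
  h.dirichletForm_eigen i ▸ dirichletForm_nonneg G π _

theorem pairing_singleGenerator_eigen (h : Diagonalizes G π l f) (g : V → ℝ) (i : ι) :
    pairing π (singleGenerator G π g) (f i) = -l i * pairing π g (f i) := by
  rw [pairing_singleGenerator_comm, h.eigen, pairing_comm, pairing_smul_left, pairing_comm]

theorem dirichletForm_eq_sum (h : Diagonalizes G π l f) (g : V → ℝ) :
    dirichletForm G π g = ∑ i, l i * pairing π g (f i) ^ 2 := by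
  rw [← neg_neg (dirichletForm G π g), ← pairing_singleGenerator_self, ← h.parseval,
    ← Finset.sum_neg_distrib]
  exact Finset.sum_congr rfl fun i _ => by rw [h.pairing_singleGenerator_eigen]; ring

theorem pairing_eq_zero_of_eigenvalue_eq_zero (h : Diagonalizes G π l f) {i : ι} (hi : l i = 0)
    {g : V → ℝ} (hg : MeanZero π g) : pairing π g (f i) = 0 := by
  obtain ⟨x⟩ := G.connected.nonempty
  have hc := eq_of_dirichletForm_eq_zero G π ((h.dirichletForm_eigen i).trans hi)
  calc pairing π g (f i) = (∑ y, π.w y * g y) * f i x := by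
        rw [pairing, Finset.sum_mul]
        exact Finset.sum_congr rfl fun y _ => by rw [hc y x]; ring
    _ = 0 := by rw [hg, zero_mul]

theorem meanZero_of_eigenvalue_ne_zero (h : Diagonalizes G π l f) {i : ι} (hi : l i ≠ 0) :
    MeanZero π (f i) := by
  have h1 := h.pairing_singleGenerator_eigen 1 i
  rw [pairing_singleGenerator] at h1
  have h2 : pairing π 1 (f i) = 0 := by
    simpa [hi] using h1
  simpa [pairing, MeanZero] using h2

theorem spectralGap_le_eigenvalue (h : Diagonalizes G π l f) {i : ι} (hi : l i ≠ 0) :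
    spectralGap G π ≤ l i := by
  have := spectralGap_mul_le G π (h.meanZero_of_eigenvalue_ne_zero hi)
  rwa [h.norm_one, mul_one, h.dirichletForm_eigen] at this

end Diagonalizes

theorem meanZero_edgeVec (π : SiteWeights V) (x y : V) : MeanZero π (edgeVec π x y) :=
  sum_weight_mul_edgeVec π x y

/-- The gap is the least nonzero eigenvalue. The vector `edgeVec` of two distinct vertices is
nonzero and of mean zero, so a nonzero eigenvalue exists and the infimum of Rayleigh quotients is
not over the empty set. -/
theorem Diagonalizes.exists_eigenvalue_eq_spectralGap {G : WeightedGraph V} {π : SiteWeights V}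
    {ι : Type*} [Fintype ι] {l : ι → ℝ} {f : ι → V → ℝ} (h : Diagonalizes G π l f)
    (hV : 1 < Fintype.card V) : ∃ i, l i ≠ 0 ∧ l i = spectralGap G π := by
  obtain ⟨x, y, hxy⟩ := Fintype.one_lt_card_iff.1 hV
  have hb := edgeWeight_mul_pairing_edgeVec π hxy
  have hb0 : pairing π (edgeVec π x y) (edgeVec π x y) ≠ 0 := fun h0 => by simp [h0] at hb
  classical
  have hne : (Finset.univ.filter fun i => l i ≠ 0).Nonempty := by
    by_contra hcon
    rw [Finset.not_nonempty_iff_eq_empty, Finset.filter_eq_empty_iff] at hcon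
    refine hb0 ?_
    rw [← h.parseval]
    refine Finset.sum_eq_zero fun i hi => ?_
    rw [h.pairing_eq_zero_of_eigenvalue_eq_zero (not_not.1 (hcon hi)) (meanZero_edgeVec π x y),
      zero_mul]
  obtain ⟨i, hi, hmin⟩ := Finset.exists_min_image _ l hne
  have hi0 := (Finset.mem_filter.1 hi).2
  refine ⟨i, hi0, le_antisymm ?_ (h.spectralGap_le_eigenvalue hi0)⟩
  rw [spectralGap_eq]
  refine le_csInf ⟨_, edgeVec π x y, fun h0 => hb0 (by simp [h0, pairing]),
    meanZero_edgeVec π x y, rfl⟩ ?_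
  rintro r ⟨g, hg0, hg, rfl⟩
  have hpos : 0 < pairing π g g := lt_of_le_of_ne (pairing_self_nonneg π g)
    fun h => hg0 (eq_zero_of_pairing_self π h.symm)
  rw [le_div_iff₀ hpos, h.dirichletForm_eq_sum, ← h.parseval, Finset.mul_sum]
  refine Finset.sum_le_sum fun j _ => ?_
  by_cases hj : l j = 0
  · rw [h.pairing_eq_zero_of_eigenvalue_eq_zero hj hg]
    simp
  · rw [← sq]
    exact mul_le_mul_of_nonneg_right (hmin j (by simp [hj])) (sq_nonneg _)

theorem spectralGap_pos (G : WeightedGraph V) (π : SiteWeights V) (hV : 1 < Fintype.card V) :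
    0 < spectralGap G π := by
  obtain ⟨l, f, h⟩ := exists_diagonalizes G π
  obtain ⟨i, hi, he⟩ := h.exists_eigenvalue_eq_spectralGap hV
  exact he ▸ lt_of_le_of_ne (h.eigenvalue_nonneg i) hi.symm

/-- The squared norm `‖e^{rL} g‖²` in `L²(V, π)`, in the eigenbasis. -/
def heatNorm (π : SiteWeights V) {ι : Type*} [Fintype ι] (l : ι → ℝ) (f : ι → V → ℝ)
    (r : ℝ) (g : V → ℝ) : ℝ :=
  ∑ i, Real.exp (-(2 * l i * r)) * pairing π g (f i) ^ 2

namespace Diagonalizes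

variable {G : WeightedGraph V} {π : SiteWeights V} {ι : Type*} [Fintype ι]
  {l : ι → ℝ} {f : ι → V → ℝ}

theorem heatNorm_zero (h : Diagonalizes G π l f) (g : V → ℝ) :
    heatNorm π l f 0 g = pairing π g g := by
  simp only [heatNorm, mul_zero, neg_zero, Real.exp_zero, one_mul, sq, h.parseval]

theorem heatNorm_le (h : Diagonalizes G π l f) {g : V → ℝ} (hg : MeanZero π g) {r s : ℝ}
    (hr : r ≤ s) :
    heatNorm π l f s g ≤ Real.exp (-(2 * spectralGap G π * (s - r))) * heatNorm π l f r g := by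
  rw [heatNorm, heatNorm, Finset.mul_sum]
  refine Finset.sum_le_sum fun i _ => ?_
  by_cases hi : l i = 0
  · simp [h.pairing_eq_zero_of_eigenvalue_eq_zero hi hg]
  · rw [← mul_assoc, ← Real.exp_add]
    refine mul_le_mul_of_nonneg_right (Real.exp_le_exp.2 ?_) (sq_nonneg _)
    nlinarith [h.spectralGap_le_eigenvalue hi]

theorem heatNorm_le_pairing (h : Diagonalizes G π l f) (g : V → ℝ) {r : ℝ} (hr : 0 ≤ r) :
    heatNorm π l f r g ≤ pairing π g g := by
  rw [← h.heatNorm_zero, heatNorm, heatNorm]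
  refine Finset.sum_le_sum fun i _ => mul_le_mul_of_nonneg_right
    (Real.exp_le_exp.2 ?_) (sq_nonneg _)
  nlinarith [mul_nonneg (h.eigenvalue_nonneg i) hr]

end Diagonalizes

theorem heatNorm_nonneg (π : SiteWeights V) {ι : Type*} [Fintype ι] (l : ι → ℝ) (f : ι → V → ℝ)
    (r : ℝ) (g : V → ℝ) : 0 ≤ heatNorm π l f r g :=
  Finset.sum_nonneg fun _ _ => mul_nonneg (Real.exp_pos _).le (sq_nonneg _)

theorem heatNorm_sub_le (π : SiteWeights V) {ι : Type*} [Fintype ι] (l : ι → ℝ) (f : ι → V → ℝ)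
    (r : ℝ) (g h : V → ℝ) :
    heatNorm π l f r (g - h) ≤ 2 * heatNorm π l f r g + 2 * heatNorm π l f r h := by
  simp only [heatNorm, Finset.mul_sum, ← Finset.sum_add_distrib]
  refine Finset.sum_le_sum fun i _ => ?_
  rw [pairing_sub_left]
  nlinarith [mul_nonneg (Real.exp_pos (-(2 * l i * r))).le
    (sq_nonneg (pairing π g (f i) + pairing π h (f i)))]

/-! ### The semigroup of the Averaging process -/

theorem exp_zero_smul {A : Type*} [NormedRing A] [NormedAlgebra ℝ A] (a : A) :
    NormedSpace.exp ((0 : ℝ) • a) = 1 := by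
  rw [zero_smul, NormedSpace.exp_zero]

theorem exp_add_smul {A : Type*} [NormedRing A] [NormedAlgebra ℝ A] [CompleteSpace A] (a : A)
    (s t : ℝ) :
    NormedSpace.exp ((s + t) • a) = NormedSpace.exp (s • a) * NormedSpace.exp (t • a) := by
  let _ : NormedAlgebra ℚ A := NormedAlgebra.restrictScalars ℚ ℝ A
  rw [add_smul]
  exact NormedSpace.exp_add_of_commute (((Commute.refl a).smul_left s).smul_right t)

theorem hasDerivAt_clm_exp_smul {A : Type*} [NormedRing A] [NormedAlgebra ℝ A] [CompleteSpace A]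
    (φ : A →L[ℝ] ℝ) (a : A) (t : ℝ) :
    HasDerivAt (fun t : ℝ => φ (NormedSpace.exp (t • a))) (φ (NormedSpace.exp (t • a) * a)) t :=
  φ.hasFDerivAt.comp_hasDerivAt t (hasDerivAt_exp_smul_const a t)

/-- The function `t ↦ (S_t F)(η)`, for real times `t`. -/
def evol (G : WeightedGraph V) (π : SiteWeights V) (η : stdSimplex ℝ V)
    (F : C(stdSimplex ℝ V, ℝ)) (t : ℝ) : ℝ :=
  (NormedSpace.exp (t • generator G π) : C(stdSimplex ℝ V, ℝ) →L[ℝ] C(stdSimplex ℝ V, ℝ)) F η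

section evol

variable (G : WeightedGraph V) (π : SiteWeights V) (η : stdSimplex ℝ V)

theorem semigroup_eq_evol (t : ℝ≥0) (F : C(stdSimplex ℝ V, ℝ)) :
    semigroup G π t F η = evol G π η F t := rfl

theorem evol_zero (F : C(stdSimplex ℝ V, ℝ)) : evol G π η F 0 = F η := by
  have h := exp_zero_smul (A := C(stdSimplex ℝ V, ℝ) →L[ℝ] C(stdSimplex ℝ V, ℝ)) (generator G π)
  exact congrArg (fun T : C(stdSimplex ℝ V, ℝ) →L[ℝ] C(stdSimplex ℝ V, ℝ) => T F η) h

theorem evol_add (F H : C(stdSimplex ℝ V, ℝ)) (t : ℝ) :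
    evol G π η (F + H) t = evol G π η F t + evol G π η H t := by
  simp [evol]

theorem evol_sub (F H : C(stdSimplex ℝ V, ℝ)) (t : ℝ) :
    evol G π η (F - H) t = evol G π η F t - evol G π η H t := by
  simp [evol]

theorem evol_smul (a : ℝ) (F : C(stdSimplex ℝ V, ℝ)) (t : ℝ) :
    evol G π η (a • F) t = a * evol G π η F t := by
  simp [evol]

theorem evol_sum {ι : Type*} (s : Finset ι) (F : ι → C(stdSimplex ℝ V, ℝ)) (t : ℝ) :
    evol G π η (∑ i ∈ s, F i) t = ∑ i ∈ s, evol G π η (F i) t := by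
  simp [evol, map_sum]

theorem evol_one {t : ℝ} (ht : 0 ≤ t) : evol G π η 1 t = 1 := by
  exact congrArg (fun F : C(stdSimplex ℝ V, ℝ) => F η) (semigroup_one G π ⟨t, ht⟩)

theorem evol_nonneg {F : C(stdSimplex ℝ V, ℝ)} (hF : ∀ ζ, 0 ≤ F ζ) {t : ℝ} (ht : 0 ≤ t) :
    0 ≤ evol G π η F t :=
  semigroup_nonneg G π ⟨t, ht⟩ F hF η

theorem evol_mono {F H : C(stdSimplex ℝ V, ℝ)} (hF : ∀ ζ, F ζ ≤ H ζ) {t : ℝ} (ht : 0 ≤ t) :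
    evol G π η F t ≤ evol G π η H t := by
  have := evol_nonneg G π η (F := H - F) (fun ζ => sub_nonneg.2 (hF ζ)) ht
  rw [evol_sub] at this
  linarith

/-- The Markov property, used to spend a first relaxation time on forgetting the initial state. -/
theorem evol_add_time (F : C(stdSimplex ℝ V, ℝ)) (s t : ℝ) :
    evol G π η F (s + t) = evol G π η
      ((NormedSpace.exp (t • generator G π) : C(stdSimplex ℝ V, ℝ) →L[ℝ] C(stdSimplex ℝ V, ℝ)) F)
      s := by
  have h := exp_add_smul (A := C(stdSimplex ℝ V, ℝ) →L[ℝ] C(stdSimplex ℝ V, ℝ))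
    (generator G π) s t
  exact congrArg (fun T : C(stdSimplex ℝ V, ℝ) →L[ℝ] C(stdSimplex ℝ V, ℝ) => T F η) h

theorem hasDerivAt_evol (F : C(stdSimplex ℝ V, ℝ)) (t : ℝ) :
    HasDerivAt (evol G π η F) (evol G π η (generator G π F) t) t := by
  exact hasDerivAt_clm_exp_smul (A := C(stdSimplex ℝ V, ℝ) →L[ℝ] C(stdSimplex ℝ V, ℝ))
    ((ContinuousMap.evalCLM ℝ η).comp (ContinuousLinearMap.apply ℝ C(stdSimplex ℝ V, ℝ) F))
    (generator G π) t

theorem generator_apply (F : C(stdSimplex ℝ V, ℝ)) :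
    generator G π F η = 1 / 2 * ∑ x, ∑ y, G.c x y * (F (averageMap π x y η) - F η) := by
  simp [generator, WeightedGraph.edgeSum, averageOp]

end evol

/-! ### Quadratic functionals -/

/-- The centered density `η/π - 1`. -/
def centered (π : SiteWeights V) (ζ : stdSimplex ℝ V) : V → ℝ := fun x => ζ x / π.w x - 1

theorem continuous_centered (π : SiteWeights V) : Continuous (centered π) := by
  refine continuous_pi fun x => ?_
  exact ((((continuous_apply x).comp continuous_subtype_val)).div_const _).sub continuous_const

theorem continuous_centered_apply (π : SiteWeights V) (x : V) :
    Continuous fun ζ => centered π ζ x :=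
  (continuous_apply x).comp (continuous_centered π)

theorem meanZero_centered (π : SiteWeights V) (ζ : stdSimplex ℝ V) :
    MeanZero π (centered π ζ) := by
  have h : ∀ x, π.w x * centered π ζ x = ζ.1 x - π.w x := fun x => by
    have := (π.pos x).ne'
    change π.w x * (ζ.1 x / π.w x - 1) = _
    field_simp
  simp only [MeanZero, h, Finset.sum_sub_distrib, ζ.2.2, π.sum_eq_one, sub_self]

/-- Splitting mass in proportion to `π` is the dual of resampling, which is self-adjoint. So the
density is updated by the same projection as a function. -/
theorem centered_averageMap (π : SiteWeights V) (x y : V) (ζ : stdSimplex ℝ V) :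
    centered π (averageMap π x y ζ) = centered π ζ
      - (edgeWeight π x y * (centered π ζ x - centered π ζ y)) • edgeVec π x y := by
  classical
  rw [← pairResample_eq]
  have hx := π.pos x
  have hy := π.pos y
  funext z
  change averageFun π x y ζ.1 z / π.w z - 1 = pairResample π x y (fun x => ζ.1 x / π.w x - 1) z
  unfold averageFun pairResample
  by_cases h1 : z = x
  · subst h1
    simp only [if_true, true_or]
    field_simp
    ring
  · by_cases h2 : z = y
    · subst h2
      simp only [h1, if_true, if_false, or_true]
      field_simp
      ring
    · simp [h1, h2]

theorem continuous_pairing (π : SiteWeights V) (g : stdSimplex ℝ V → V → ℝ) (hg : Continuous g)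
    (h : stdSimplex ℝ V → V → ℝ) (hh : Continuous h) :
    Continuous fun ζ => pairing π (g ζ) (h ζ) :=
  continuous_finsetSum _ fun x _ => continuous_const.mul
    (((continuous_apply x).comp hg).mul ((continuous_apply x).comp hh))

/-- The linear functional `⟨η/π - 1, g⟩`. -/
def coordFun (π : SiteWeights V) (g : V → ℝ) : C(stdSimplex ℝ V, ℝ) :=
  ⟨fun ζ => pairing π (centered π ζ) g,
    continuous_pairing π _ (continuous_centered π) _ continuous_const⟩

/-- The functional `⟨η/π - 1, g⟩²`. -/
def coordSq (π : SiteWeights V) (g : V → ℝ) : C(stdSimplex ℝ V, ℝ) := coordFun π g ^ 2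

/-- The squared distance `‖η/π - 1‖²`. -/
def sqDist (π : SiteWeights V) : C(stdSimplex ℝ V, ℝ) :=
  ⟨fun ζ => pairing π (centered π ζ) (centered π ζ),
    continuous_pairing π _ (continuous_centered π) _ (continuous_centered π)⟩

/-- The functional `∑_{xy} c_{xy} a_{xy} (ψ(x) - ψ(y))²`, for `ψ = η/π - 1`. -/
def energy (G : WeightedGraph V) (π : SiteWeights V) (a : V → V → ℝ) : C(stdSimplex ℝ V, ℝ) :=
  ⟨fun ζ => 1 / 2 * ∑ x, ∑ y, G.c x y * (a x y * (centered π ζ x - centered π ζ y) ^ 2), by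
    have := continuous_centered_apply π
    fun_prop⟩

theorem energy_apply (G : WeightedGraph V) (π : SiteWeights V) (a : V → V → ℝ)
    (ζ : stdSimplex ℝ V) : energy G π a ζ =
      1 / 2 * ∑ x, ∑ y, G.c x y * (a x y * (centered π ζ x - centered π ζ y) ^ 2) := rfl

theorem energy_nonneg (G : WeightedGraph V) (π : SiteWeights V) {a : V → V → ℝ}
    (ha : ∀ x y, 0 ≤ a x y) (ζ : stdSimplex ℝ V) : 0 ≤ energy G π a ζ :=
  mul_nonneg (by norm_num) (Finset.sum_nonneg fun x _ => Finset.sum_nonneg fun y _ =>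
    mul_nonneg (G.c_nonneg x y) (mul_nonneg (ha x y) (sq_nonneg _)))

theorem energy_mono (G : WeightedGraph V) (π : SiteWeights V) {a b : V → V → ℝ}
    (h : ∀ x y, a x y ≤ b x y) (ζ : stdSimplex ℝ V) : energy G π a ζ ≤ energy G π b ζ :=
  mul_le_mul_of_nonneg_left (Finset.sum_le_sum fun x _ => Finset.sum_le_sum fun y _ =>
    mul_le_mul_of_nonneg_left (mul_le_mul_of_nonneg_right (h x y) (sq_nonneg _))
      (G.c_nonneg x y)) (by norm_num)

theorem energy_smul (G : WeightedGraph V) (π : SiteWeights V) (a : V → V → ℝ) (r : ℝ) :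
    energy G π (fun x y => r * a x y) = r • energy G π a := by
  ext ζ
  simp only [energy_apply, ContinuousMap.smul_apply, smul_eq_mul, Finset.mul_sum]
  exact Finset.sum_congr rfl fun x _ => Finset.sum_congr rfl fun y _ => by ring

theorem energy_sum (G : WeightedGraph V) (π : SiteWeights V) {ι : Type*} [Fintype ι]
    (a : ι → V → V → ℝ) :
    ∑ i, energy G π (a i) = energy G π fun x y => ∑ i, a i x y := by
  ext ζ
  simp only [energy_apply, ContinuousMap.sum_apply, Finset.mul_sum, Finset.sum_mul]
  rw [Finset.sum_comm]
  refine Finset.sum_congr rfl fun x _ => ?_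
  rw [Finset.sum_comm]

theorem coordFun_averageMap (π : SiteWeights V) (g : V → ℝ) (x y : V) (ζ : stdSimplex ℝ V) :
    coordFun π g (averageMap π x y ζ) = coordFun π g ζ
      - edgeWeight π x y * ((centered π ζ x - centered π ζ y) * (g x - g y)) := by
  change pairing π (centered π (averageMap π x y ζ)) g = pairing π (centered π ζ) g - _
  rw [centered_averageMap, pairing_sub_left, pairing_smul_left, pairing_edgeVec]
  ring

/-- Pythagoras for the projection: the loss is the squared length of the removed component. -/
theorem sqDist_averageMap (π : SiteWeights V) (x y : V) (ζ : stdSimplex ℝ V) :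
    sqDist π (averageMap π x y ζ) = sqDist π ζ
      - edgeWeight π x y * (centered π ζ x - centered π ζ y) ^ 2 := by
  change pairing π (centered π (averageMap π x y ζ)) (centered π (averageMap π x y ζ))
    = pairing π (centered π ζ) (centered π ζ) - _
  rw [centered_averageMap]
  set u := centered π ζ
  by_cases hxy : x = y
  · subst hxy
    simp
  have h := edgeWeight_mul_pairing_edgeVec π hxy
  rw [pairing_sub_left, pairing_comm π u, pairing_sub_left, pairing_smul_left,
    pairing_comm π (_ • _) (_ - _), pairing_sub_left, pairing_smul_left, pairing_comm π u (_ • _),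
    pairing_smul_left, pairing_comm π _ (_ • _), pairing_smul_left, pairing_edgeVec π x y u]
  linear_combination (edgeWeight π x y * (u x - u y) ^ 2) * h

theorem generator_coordFun (G : WeightedGraph V) (π : SiteWeights V) (g : V → ℝ)
    (ζ : stdSimplex ℝ V) :
    generator G π (coordFun π g) ζ = pairing π (singleGenerator G π (centered π ζ)) g := by
  simp only [generator_apply, coordFun_averageMap, pairing_singleGenerator, sub_sub_cancel_left,
    mul_neg, Finset.sum_neg_distrib]

theorem generator_sqDist (G : WeightedGraph V) (π : SiteWeights V) :
    generator G π (sqDist π) = -energy G π (edgeWeight π) := by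
  ext ζ
  simp only [generator_apply, sqDist_averageMap, energy_apply, ContinuousMap.neg_apply,
    sub_sub_cancel_left, mul_neg, Finset.sum_neg_distrib]

/-- The energy term is the carré du champ of `coordFun`: the noise in the direction `g` injected by
the updates. -/
theorem generator_coordSq (G : WeightedGraph V) (π : SiteWeights V) (g : V → ℝ)
    (ζ : stdSimplex ℝ V) :
    generator G π (coordSq π g) ζ
      = 2 * coordFun π g ζ * generator G π (coordFun π g) ζ
        + energy G π (fun x y => (edgeWeight π x y * (g x - g y)) ^ 2) ζ := by
  simp only [generator_apply, coordSq, energy_apply, ContinuousMap.pow_apply, coordFun_averageMap,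
    Finset.mul_sum, ← Finset.sum_add_distrib]
  exact Finset.sum_congr rfl fun x _ => Finset.sum_congr rfl fun y _ => by ring

/-! ### Evolution of the squared distance -/

theorem le_of_hasDerivAt_nonneg_on {φ φ' : ℝ → ℝ} {a b : ℝ} (hab : a ≤ b)
    (hd : ∀ s, a ≤ s → s ≤ b → HasDerivAt φ (φ' s) s) (h : ∀ s, a ≤ s → s ≤ b → 0 ≤ φ' s) :
    φ a ≤ φ b := by
  refine monotoneOn_of_hasDerivWithinAt_nonneg (D := Set.Icc a b) (f' := φ') (convex_Icc a b)
    (fun s hs => (hd s hs.1 hs.2).continuousAt.continuousWithinAt) (fun s hs => ?_)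
    (fun s hs => ?_) ⟨le_rfl, hab⟩ ⟨hab, le_rfl⟩ hab
  all_goals have hs' := interior_subset hs
  · exact (hd s hs'.1 hs'.2).hasDerivWithinAt
  · exact h s hs'.1 hs'.2

theorem le_of_hasDerivAt_nonneg {φ φ' : ℝ → ℝ} {a b : ℝ} (hab : a ≤ b)
    (hd : ∀ s, HasDerivAt φ (φ' s) s) (h : ∀ s, a ≤ s → s ≤ b → 0 ≤ φ' s) : φ a ≤ φ b :=
  le_of_hasDerivAt_nonneg_on hab (fun s _ _ => hd s) h

theorem hasDerivAt_evol_sqDist (G : WeightedGraph V) (π : SiteWeights V) (η : stdSimplex ℝ V)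
    (t : ℝ) : HasDerivAt (evol G π η (sqDist π)) (-evol G π η (energy G π (edgeWeight π)) t) t := by
  have h := hasDerivAt_evol G π η (sqDist π) t
  rw [generator_sqDist] at h
  convert h using 1
  simp [evol]

theorem sqDist_nonneg (π : SiteWeights V) (ζ : stdSimplex ℝ V) : 0 ≤ sqDist π ζ :=
  pairing_self_nonneg π _

theorem energy_edgeWeight_nonneg (G : WeightedGraph V) (π : SiteWeights V) (ζ : stdSimplex ℝ V) :
    0 ≤ energy G π (edgeWeight π) ζ :=
  energy_nonneg G π (fun x y => (edgeWeight_pos π x y).le) ζ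

theorem evol_sqDist_antitone (G : WeightedGraph V) (π : SiteWeights V) (η : stdSimplex ℝ V)
    {s t : ℝ} (hs : 0 ≤ s) (hst : s ≤ t) :
    evol G π η (sqDist π) t ≤ evol G π η (sqDist π) s := by
  have := le_of_hasDerivAt_nonneg hst (fun r => (hasDerivAt_evol_sqDist G π η r).neg)
    (fun r hr _ => by
      rw [neg_neg]
      exact evol_nonneg G π η (energy_edgeWeight_nonneg G π) (hs.trans hr))
  simpa using this

/-- Gronwall with the energy identity and the gap. The rate is `g` and not `2g`, since the
derivative of `E‖ψ‖²` is minus one Dirichlet form, against two for the heat flow. -/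
theorem evol_sqDist_le_exp (G : WeightedGraph V) (π : SiteWeights V) (η : stdSimplex ℝ V)
    {t : ℝ} (ht : 0 ≤ t) :
    evol G π η (sqDist π) t ≤ Real.exp (-(spectralGap G π * t)) * sqDist π η := by
  set g := spectralGap G π
  have hd : ∀ r, HasDerivAt (fun r => -(Real.exp (g * r) * evol G π η (sqDist π) r))
      (-(Real.exp (g * r) * g * evol G π η (sqDist π) r
        + Real.exp (g * r) * -evol G π η (energy G π (edgeWeight π)) r)) r := fun r => by
    have h1 : HasDerivAt (fun r => Real.exp (g * r)) (Real.exp (g * r) * g) r := by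
      simpa using ((hasDerivAt_id r).const_mul g).exp
    exact (h1.mul (hasDerivAt_evol_sqDist G π η r)).neg
  have h := le_of_hasDerivAt_nonneg ht hd fun r hr _ => by
    have h2 := evol_mono G π η (F := g • sqDist π) (H := energy G π (edgeWeight π))
      (fun ζ => spectralGap_mul_le G π (meanZero_centered π ζ)) hr
    rw [evol_smul] at h2
    nlinarith [Real.exp_pos (g * r)]
  simp only [mul_zero, Real.exp_zero, one_mul, evol_zero, neg_le_neg_iff] at h
  rw [Real.exp_neg, inv_mul_eq_div, le_div_iff₀ (Real.exp_pos _)]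
  linarith

/-! ### Duhamel's formula -/

/-- The interpolation `s ↦ E‖e^{(t-s)L}(η_s/π - 1)‖²`. -/
def interpolation (G : WeightedGraph V) (π : SiteWeights V) {ι : Type*} [Fintype ι]
    (l : ι → ℝ) (f : ι → V → ℝ) (η : stdSimplex ℝ V) (t s : ℝ) : ℝ :=
  ∑ i, Real.exp (-(2 * l i * (t - s))) * evol G π η (coordSq π (f i)) s

namespace Diagonalizes

variable {G : WeightedGraph V} {π : SiteWeights V} {ι : Type*} [Fintype ι]
  {l : ι → ℝ} {f : ι → V → ℝ}

theorem interpolation_zero (η : stdSimplex ℝ V) (t : ℝ) :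
    interpolation G π l f η t 0 = heatNorm π l f t (centered π η) := by
  simp only [interpolation, sub_zero, evol_zero]
  rfl

theorem interpolation_self (h : Diagonalizes G π l f) (η : stdSimplex ℝ V) (t : ℝ) :
    interpolation G π l f η t t = evol G π η (sqDist π) t := by
  simp only [interpolation, sub_self, mul_zero, neg_zero, Real.exp_zero, one_mul, ← evol_sum]
  congr 1
  ext ζ
  simp only [ContinuousMap.sum_apply]
  refine Eq.trans (Finset.sum_congr rfl fun i _ => ?_)
    (h.parseval (centered π ζ) (centered π ζ))
  exact sq _

theorem generator_coordSq_eigen (h : Diagonalizes G π l f) (i : ι) :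
    generator G π (coordSq π (f i)) = (-(2 * l i)) • coordSq π (f i)
      + energy G π (fun x y => (edgeWeight π x y * (f i x - f i y)) ^ 2) := by
  ext ζ
  rw [generator_coordSq, generator_coordFun, h.pairing_singleGenerator_eigen]
  simp only [ContinuousMap.add_apply, ContinuousMap.smul_apply, smul_eq_mul, coordSq,
    ContinuousMap.pow_apply]
  change 2 * coordFun π (f i) ζ * (-l i * coordFun π (f i) ζ) + _ = _
  ring

/-- Along each eigenvector the drift of `coordSq` cancels the derivative of the exponential weight.
What remains is the noise born at time `s`, smoothed for the remaining time `t - s`. -/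
theorem hasDerivAt_interpolation (h : Diagonalizes G π l f) (η : stdSimplex ℝ V) (t s : ℝ) :
    HasDerivAt (interpolation G π l f η t)
      (evol G π η (energy G π fun x y =>
        edgeWeight π x y ^ 2 * heatNorm π l f (t - s) (edgeVec π x y)) s) s := by
  have hterm : ∀ i ∈ Finset.univ, HasDerivAt
      (fun s => Real.exp (-(2 * l i * (t - s))) * evol G π η (coordSq π (f i)) s)
      (evol G π η (energy G π fun x y => Real.exp (-(2 * l i * (t - s))) *
        (edgeWeight π x y * (f i x - f i y)) ^ 2) s) s := by
    intro i _
    have h1 : HasDerivAt (fun s => Real.exp (-(2 * l i * (t - s))))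
        (Real.exp (-(2 * l i * (t - s))) * (2 * l i)) s := by
      have := ((((hasDerivAt_id s).const_sub t).const_mul (2 * l i)).neg).exp
      simpa using this
    have h2 := h1.mul (hasDerivAt_evol G π η (coordSq π (f i)) s)
    rw [h.generator_coordSq_eigen, evol_add, evol_smul] at h2
    rw [energy_smul, evol_smul]
    convert! h2 using 1
    ring
  have hsum := HasDerivAt.fun_sum hterm
  rw [← evol_sum, energy_sum] at hsum
  have he : (fun x y => edgeWeight π x y ^ 2 * heatNorm π l f (t - s) (edgeVec π x y)) =
      fun x y => ∑ i, Real.exp (-(2 * l i * (t - s))) *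
        (edgeWeight π x y * (f i x - f i y)) ^ 2 := by
    funext x y
    rw [heatNorm, Finset.mul_sum]
    refine Finset.sum_congr rfl fun i _ => ?_
    rw [pairing_edgeVec]
    ring
  rw [he]
  exact hsum

theorem interpolation_deriv_nonneg (η : stdSimplex ℝ V) (t : ℝ) {s : ℝ} (hs : 0 ≤ s) :
    0 ≤ evol G π η (energy G π fun x y =>
        edgeWeight π x y ^ 2 * heatNorm π l f (t - s) (edgeVec π x y)) s :=
  evol_nonneg G π η (energy_nonneg G π fun x y =>
    mul_nonneg (sq_nonneg (edgeWeight π x y))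
      (heatNorm_nonneg π l f _ (edgeVec π x y))) hs

theorem interpolation_deriv_le (η : stdSimplex ℝ V) {t s κ : ℝ} (hs : 0 ≤ s)
    (hκ : ∀ x y, edgeWeight π x y * heatNorm π l f (t - s) (edgeVec π x y) ≤ κ) :
    evol G π η (energy G π fun x y =>
        edgeWeight π x y ^ 2 * heatNorm π l f (t - s) (edgeVec π x y)) s
      ≤ κ * evol G π η (energy G π (edgeWeight π)) s := by
  rw [← evol_smul, ← energy_smul]
  refine evol_mono G π η (energy_mono G π fun x y => ?_) hs
  nlinarith [hκ x y, edgeWeight_pos π x y]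

/-- Jensen's inequality, seen as monotonicity of the interpolation. It passes bounds on the
Averaging process to the heat flow. -/
theorem heatNorm_centered_le (h : Diagonalizes G π l f) (η : stdSimplex ℝ V) {t : ℝ}
    (ht : 0 ≤ t) : heatNorm π l f t (centered π η) ≤ evol G π η (sqDist π) t := by
  rw [← h.interpolation_self, ← interpolation_zero (G := G)]
  exact le_of_hasDerivAt_nonneg ht (h.hasDerivAt_interpolation η t)
    fun s hs _ => interpolation_deriv_nonneg η t hs

/-- Without any smoothing, the noise on an edge is at most the energy dissipated there, because
`edgeWeight * ‖edgeVec‖² ≤ 1`. So the sum of the interpolation and `E‖ψ_s‖²` is nonincreasing in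
`s`. -/
theorem interpolation_le_near (h : Diagonalizes G π l f) (η : stdSimplex ℝ V) {t s : ℝ}
    (hs : 0 ≤ s) (hst : s ≤ t) :
    2 * evol G π η (sqDist π) t ≤ interpolation G π l f η t s + evol G π η (sqDist π) s := by
  have := le_of_hasDerivAt_nonneg hst (fun r =>
    ((h.hasDerivAt_interpolation η t r).add (hasDerivAt_evol_sqDist G π η r)).neg)
    fun r hr hrt => by
      have := interpolation_deriv_le (G := G) (l := l) (f := f) η (hs.trans hr) fun x y =>
        (mul_le_mul_of_nonneg_left (h.heatNorm_le_pairing (edgeVec π x y) (sub_nonneg.2 hrt))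
          (edgeWeight_pos π x y).le).trans (edgeWeight_mul_pairing_edgeVec_le π x y)
      linarith
  simp only [Pi.add_apply, Pi.neg_apply, h.interpolation_self] at this
  linarith

/-- Up to time `s` the noise still has at least `t - s` units of smoothing ahead, so it is at most
`β e^{-2g(t-r)}` times the dissipation at time `r`. The latter is minus the derivative of `E‖ψ_r‖² ≤
e^{-gr} v`. -/
theorem interpolation_le_far (h : Diagonalizes G π l f) (η : stdSimplex ℝ V) {t s β : ℝ}
    (hs : 0 ≤ s) (hst : s ≤ t) (hβ : 0 ≤ β) (hg : 0 ≤ spectralGap G π)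
    (hκ : ∀ r, t - s ≤ r → ∀ x y, edgeWeight π x y * heatNorm π l f r (edgeVec π x y) ≤
      β * Real.exp (-(2 * spectralGap G π * r))) :
    interpolation G π l f η t s ≤
      (Real.exp (-(2 * spectralGap G π * t)) + 3 * β * Real.exp (-(spectralGap G π * t)))
        * sqDist π η := by
  set g := spectralGap G π
  set v := sqDist π η
  have hv : 0 ≤ v := sqDist_nonneg π η
  have he : ∀ r, HasDerivAt (fun r => Real.exp (-(2 * g * (t - r))))
      (Real.exp (-(2 * g * (t - r))) * (2 * g)) r := fun r => by
    have := ((((hasDerivAt_id r).const_sub t).const_mul (2 * g)).neg).exp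
    simpa using this
  have he' : ∀ r, HasDerivAt (fun r => Real.exp (g * r - 2 * g * t))
      (Real.exp (g * r - 2 * g * t) * g) r := fun r => by
    have := (((hasDerivAt_id r).const_mul g).sub_const (2 * g * t)).exp
    simpa using this
  -- Integration by parts written as monotonicity. The second summand cancels the dissipation, and
  -- the third absorbs the derivative of its weight through the bound `e^{-gr} v`.
  have key := le_of_hasDerivAt_nonneg hs (fun r =>
    (((h.hasDerivAt_interpolation η t r).add
      (((he r).mul (hasDerivAt_evol_sqDist G π η r)).const_mul β)).sub
      ((he' r).const_mul (2 * β * v))).neg)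
    fun r hr hrs => by
      have h1 := interpolation_deriv_le (G := G) η hr (hκ (t - r) (by linarith))
      have h2 := evol_sqDist_le_exp G π η hr
      have h3 : Real.exp (g * r - 2 * g * t)
          = Real.exp (-(2 * g * (t - r))) * Real.exp (-(g * r)) := by
        rw [← Real.exp_add]; congr 1; ring
      rw [h3]
      have h4 := mul_le_mul_of_nonneg_left h2
        (mul_nonneg (mul_nonneg hβ (Real.exp_pos (-(2 * g * (t - r)))).le) hg)
      change evol G π η (sqDist π) r ≤ Real.exp (-(g * r)) * v at h2
      change _ ≤ β * Real.exp (-(2 * g * (t - r))) * g * (Real.exp (-(g * r)) * v) at h4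
      nlinarith
  simp only [Pi.add_apply, Pi.neg_apply, Pi.sub_apply, Pi.mul_apply, evol_zero,
    interpolation_zero, sub_zero, mul_zero, zero_sub] at key
  have h5 : heatNorm π l f t (centered π η) ≤ Real.exp (-(2 * g * t)) * v := by
    have := h.heatNorm_le (meanZero_centered π η) (r := 0) (s := t) (hs.trans hst)
    rwa [h.heatNorm_zero, sub_zero] at this
  have h6 : Real.exp (g * s - 2 * g * t) ≤ Real.exp (-(g * t)) :=
    Real.exp_le_exp.2 (by nlinarith)
  have h7 : Real.exp (-(2 * g * t)) ≤ Real.exp (-(g * t)) :=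
    Real.exp_le_exp.2 (by nlinarith [mul_nonneg hg (hs.trans hst)])
  have h8 : 0 ≤ Real.exp (-(2 * g * (t - s))) * evol G π η (sqDist π) s :=
    mul_nonneg (Real.exp_pos _).le (evol_nonneg G π η (sqDist_nonneg π) hs)
  have hβv := mul_nonneg hβ hv
  have h9 := mul_le_mul_of_nonneg_left h6 hβv
  have h10 := mul_le_mul_of_nonneg_left h7 hβv
  have h11 := mul_nonneg hβ h8
  have h12 := mul_nonneg hβv (Real.exp_pos (-(2 * g * t))).le
  change -(heatNorm π l f t (centered π η) + β * (Real.exp (-(2 * g * t)) * v)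
    - 2 * β * v * Real.exp (-(2 * g * t))) ≤ _ at key
  nlinarith

/-- A contraction of the squared distance over a short time, up to the decay of the mean and to
a small multiple of the exponential decay. -/
theorem evol_sqDist_le_half (h : Diagonalizes G π l f) (η : stdSimplex ℝ V) {t ε β : ℝ}
    (hε : 0 ≤ ε) (hεt : ε ≤ t) (hβ : 0 ≤ β) (hg : 0 ≤ spectralGap G π)
    (hκ : ∀ r, ε ≤ r → ∀ x y, edgeWeight π x y * heatNorm π l f r (edgeVec π x y) ≤
      β * Real.exp (-(2 * spectralGap G π * r))) :
    evol G π η (sqDist π) t ≤ 1 / 2 * evol G π η (sqDist π) (t - ε) + 1 / 2 *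
      ((Real.exp (-(2 * spectralGap G π * t)) + 3 * β * Real.exp (-(spectralGap G π * t)))
        * sqDist π η) := by
  have h1 := h.interpolation_le_near η (sub_nonneg.2 hεt) (sub_le_self t hε)
  have h2 := h.interpolation_le_far η (sub_nonneg.2 hεt) (sub_le_self t hε) hβ hg
    (by simpa using hκ)
  linarith

end Diagonalizes

/-! ### Ultracontractivity from the Nash inequality -/

/-- Bernoulli's inequality as the tangent line of `X ^ p` at `y`. An affine minorant lets Jensen
follow from positivity of the semigroup and `evol_one`. -/
theorem rpow_tangent_le {X y p : ℝ} (hX : 0 ≤ X) (hy : 0 < y) (hp : 1 ≤ p) :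
    y ^ p + p * (y ^ p / y) * (X - y) ≤ X ^ p := by
  have h := one_add_mul_self_le_rpow_one_add (s := X / y - 1) (p := p)
    (by have := div_nonneg hX hy.le; linarith) hp
  rw [add_sub_cancel, Real.div_rpow hX hy.le, le_div_iff₀ (Real.rpow_pos_of_pos hy p)] at h
  refine le_trans (le_of_eq ?_) h
  field_simp

/-- Jensen's inequality along the evolution of the Nash inequality. -/
theorem nash_evol {G : WeightedGraph V} {π : SiteWeights V} {a b p : ℝ} (hp : 1 ≤ p)
    (hN : ∀ ζ, (sqDist π ζ + 1) ^ p ≤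
      a * energy G π (edgeWeight π) ζ + b * (sqDist π ζ + 1))
    (η : stdSimplex ℝ V) {t : ℝ} (ht : 0 ≤ t) :
    (evol G π η (sqDist π) t + 1) ^ p ≤
      a * evol G π η (energy G π (edgeWeight π)) t + b * (evol G π η (sqDist π) t + 1) := by
  set y := evol G π η (sqDist π) t + 1 with hy
  have hy0 : 0 < y := by
    have := evol_nonneg G π η (sqDist_nonneg π) ht
    linarith
  -- The slope of the tangent at the mean `y`, so that the linear part averages to zero.
  set m := p * (y ^ p / y)
  have h := evol_mono G π η (F := m • sqDist π + (y ^ p + m * (1 - y)) • 1)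
    (H := a • energy G π (edgeWeight π) + (b • sqDist π + b • 1)) (fun ζ => by
      have h1 := rpow_tangent_le (X := sqDist π ζ + 1)
        (by have := sqDist_nonneg π ζ; linarith) hy0 hp
      have h2 := hN ζ
      simp only [ContinuousMap.add_apply, ContinuousMap.smul_apply, ContinuousMap.one_apply,
        smul_eq_mul]
      change y ^ p + m * _ ≤ _ at h1
      linarith) ht
  simp only [evol_add, evol_smul, evol_one G π η ht] at h
  have h3 : evol G π η (sqDist π) t = y - 1 := by rw [hy]; ring
  rw [h3] at h
  linarith

/-- Nash's argument: `y' = -D` and `y ^ (1 + q) ≤ a D + b y` force `y ^ (-q)` to grow linearly as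
long as `y ^ q` exceeds `2b`. The bound does not depend on the initial state. -/
theorem evol_sqDist_le_of_nash {G : WeightedGraph V} {π : SiteWeights V} {a b : ℝ} {N : ℕ}
    (hN0 : 0 < N) (ha : 0 < a) (hb : 0 < b)
    (hN : ∀ ζ, (sqDist π ζ + 1) ^ (1 + 1 / N : ℝ) ≤
      a * energy G π (edgeWeight π) ζ + b * (sqDist π ζ + 1))
    (η : stdSimplex ℝ V) {t : ℝ} (ht : 0 < t) :
    evol G π η (sqDist π) t + 1 ≤ (2 * b) ^ N + (2 * a * N / t) ^ N := by
  have hNpos : (0 : ℝ) < N := Nat.cast_pos.2 hN0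
  set q : ℝ := 1 / N with hq
  have hq0 : 0 < q := by positivity
  set y := fun s => evol G π η (sqDist π) s + 1 with hy
  have hy1 : ∀ s, 0 ≤ s → 0 < y s := fun s hs => by
    have := evol_nonneg G π η (sqDist_nonneg π) hs
    simp only [hy]; linarith
  have hqN : ∀ s, 0 ≤ s → ((y s) ^ q) ^ N = y s := fun s hs => by
    rw [← Real.rpow_natCast, ← Real.rpow_mul (hy1 s hs).le, hq, one_div_mul_cancel hNpos.ne',
      Real.rpow_one]
  have ht1 : 0 ≤ (2 * a * N / t) ^ N := by positivity
  have hb1 : 0 ≤ (2 * b) ^ N := by positivity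
  change y t ≤ _
  by_cases hyt : (y t) ^ q ≤ 2 * b
  · have := pow_le_pow_left₀ (Real.rpow_nonneg (hy1 t ht.le).le q) hyt N
    rw [hqN t ht.le] at this
    linarith
  -- As `y` is nonincreasing, `y ^ q` is above `2b` on all of `[0, t]`, so `b y` is absorbed into
  -- half of the left side.
  push Not at hyt
  set D := evol G π η (energy G π (edgeWeight π)) with hD
  have hd : ∀ s, HasDerivAt y (-D s) s := fun s => by
    exact (hasDerivAt_evol_sqDist G π η s).add_const 1
  have hdecay : ∀ s, 0 ≤ s → s ≤ t → 1 / (2 * a) ≤ y s ^ (-q - 1) * D s := by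
    intro s hs hst
    have hys := hy1 s hs
    have h1 : 2 * b ≤ (y s) ^ q := hyt.le.trans (Real.rpow_le_rpow (hy1 t ht.le).le
      (add_le_add_left (evol_sqDist_antitone G π η hs hst) 1) hq0.le)
    have h2 := nash_evol (by linarith) hN η hs
    change y s ^ (1 + q) ≤ a * D s + b * y s at h2
    have h3 : y s ^ (1 + q) = y s * y s ^ q := by rw [Real.rpow_add hys, Real.rpow_one]
    have h4 : y s ^ (-q - 1) * y s ^ (1 + q) = 1 := by
      rw [← Real.rpow_add hys, show -q - 1 + (1 + q) = 0 by ring, Real.rpow_zero]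
    have h5 : 0 < y s ^ (-q - 1) := Real.rpow_pos_of_pos hys _
    have h6 : y s ^ (1 + q) / 2 ≤ a * D s := by nlinarith
    rw [div_le_iff₀ (by positivity)]
    nlinarith
  have hz := le_of_hasDerivAt_nonneg_on ht.le (φ := fun s => y s ^ (-q) - q / (2 * a) * s)
    (φ' := fun s => q * (y s ^ (-q - 1) * D s) - q / (2 * a)) (fun s hs hst => by
      have h1 := (hd s).rpow_const (p := -q) (Or.inl (hy1 s hs).ne')
      have h2 := h1.sub ((hasDerivAt_id s).const_mul (q / (2 * a)))
      convert! h2 using 1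
      ring) (fun s hs hst => by
      have := mul_le_mul_of_nonneg_left (hdecay s hs hst) hq0.le
      have h2 : q * (1 / (2 * a)) = q / (2 * a) := by ring
      linarith)
  have h0 : 0 ≤ y 0 ^ (-q) := Real.rpow_nonneg (hy1 0 le_rfl).le _
  simp only [mul_zero, sub_zero] at hz
  have hy' := Real.rpow_pos_of_pos (hy1 t ht.le) q
  have h1 : q / (2 * a) * t ≤ (y t ^ q)⁻¹ := by
    rw [← Real.rpow_neg (hy1 t ht.le).le]; linarith
  have h2 : y t ^ q ≤ 2 * a * N / t := by
    rw [le_inv_comm₀ (by positivity) hy'] at h1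
    refine h1.trans (le_of_eq ?_)
    rw [hq]
    field_simp
  have h3 := pow_le_pow_left₀ hy'.le h2 N
  rw [hqN t ht.le] at h3
  linarith

/-! ### Iteration -/

open Classical in
theorem centered_single (π : SiteWeights V) (x : V) :
    centered π ⟨Pi.single x 1, single_mem_stdSimplex ℝ x⟩ = Pi.single x (π.w x)⁻¹ - 1 := by
  funext z
  change (Pi.single x 1 : V → ℝ) z / π.w z - 1 = (Pi.single x (π.w x)⁻¹ : V → ℝ) z - 1
  by_cases hx : z = x
  · subst hx; simp
  · simp [hx]

/-- The densities of the point masses at `x` and `y` differ by `edgeVec`, so a bound uniform over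
starting configurations also controls the smoothed noise. -/
theorem exists_edgeVec_eq_centered (π : SiteWeights V) (x y : V) :
    ∃ ζ ζ', edgeVec π x y = centered π ζ - centered π ζ' :=
  ⟨_, _, (by rw [edgeVec, sub_sub_sub_cancel_right] : edgeVec π x y = _ - 1 - (_ - 1)).trans
    (congrArg₂ (· - ·) (centered_single π x).symm (centered_single π y).symm)⟩

theorem Diagonalizes.edgeWeight_mul_heatNorm_le {G : WeightedGraph V} {π : SiteWeights V}
    {ι : Type*} [Fintype ι] {l : ι → ℝ} {f : ι → V → ℝ} (h : Diagonalizes G π l f)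
    {ε r M w : ℝ} (hε : 0 ≤ ε) (hr : ε ≤ r) (hw : ∀ x, π.w x ≤ w)
    (hM : ∀ η, evol G π η (sqDist π) ε ≤ M) (x y : V) :
    edgeWeight π x y * heatNorm π l f r (edgeVec π x y)
      ≤ w * (Real.exp (-(2 * spectralGap G π * (r - ε))) * (4 * M)) := by
  have h1 := h.heatNorm_le (meanZero_edgeVec π x y) hr
  have h2 : heatNorm π l f ε (edgeVec π x y) ≤ 4 * M := by
    obtain ⟨ζ, ζ', he⟩ := exists_edgeVec_eq_centered π x y
    rw [he]
    refine (heatNorm_sub_le π l f ε _ _).trans ?_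
    have hx := (h.heatNorm_centered_le ζ hε).trans (hM _)
    have hy := (h.heatNorm_centered_le ζ' hε).trans (hM _)
    linarith
  exact mul_le_mul ((edgeWeight_le π x y).trans (hw x))
    (h1.trans (mul_le_mul_of_nonneg_left h2 (Real.exp_pos _).le)) (heatNorm_nonneg _ _ _ _ _)
    ((π.pos x).le.trans (hw x))

/-- Iterating a contraction over geometrically decreasing times. Time is measured in units of the
relaxation time. -/
theorem iterate_half {v : ℝ → ℝ} {v0 B : ℝ} {N : ℕ} (hN : 0 < N) (hB : 0 ≤ B) (hv0 : 0 ≤ v0)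
    (hv : ∀ t, 0 ≤ t → v t ≤ v0)
    (hrec : ∀ e t, 0 < e → e ≤ 1 → e ≤ t → v t ≤ 1 / 2 * v (t - e) + 1 / 2 *
      ((Real.exp (-(2 * t)) + 3 * (B / e ^ N) * Real.exp (-t)) * v0))
    {t : ℝ} (ht : 4 * N ≤ t) :
    v t ≤ (Real.exp (-(2 * (t - 4 * N))) + 9 / 2 * B * Real.exp (-(t - 4 * N))) * v0 := by
  have hN1 : (1 : ℝ) ≤ N := Nat.one_le_cast.2 hN
  have hNpos : (0 : ℝ) < N := by linarith
  -- Steps of length `ρ ^ i` add up to `1 / (1 - ρ) = 4N`, so infinitely many fit in the time `4N`.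
  set ρ : ℝ := 1 - 1 / (4 * N) with hρ
  have hq : 1 / (4 * N : ℝ) ≤ 1 / 4 := one_div_le_one_div_of_le (by norm_num) (by linarith)
  have hq0 : 0 < 1 / (4 * N : ℝ) := by positivity
  have hρ0 : 0 < ρ := by linarith
  have hρ1 : ρ ≤ 1 := by linarith
  -- Bernoulli. The singular factor `1 / e ^ N` then grows by at most `4/3` per step, which the
  -- contraction factor `1/2` beats.
  have hρN : 3 / 4 ≤ ρ ^ N := by
    have := one_add_mul_le_pow (a := -(1 / (4 * N : ℝ))) (by linarith) N
    rw [← sub_eq_add_neg, ← hρ] at this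
    refine le_trans (le_of_eq ?_) this
    field_simp
    ring
  have hinv : ∀ i : ℕ, 1 / (ρ ^ i) ^ N ≤ (4 / 3) ^ i := fun i => by
    rw [← pow_mul, mul_comm i, pow_mul, one_div, inv_le_comm₀ (by positivity) (by positivity),
      ← inv_pow]
    exact pow_le_pow_left₀ (by norm_num) (by norm_num; linarith) i
  -- Here `m` counts the steps still to be taken and `i` is the level of the next one. The time
  -- needed from level `i` on is the tail `4N ρ ^ i` of the geometric series.
  have main : ∀ m i : ℕ, ∀ t, 4 * N * ρ ^ i ≤ t → v t ≤ ((1 / 2) ^ m +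
      (Real.exp (-(2 * (t - 4 * N * ρ ^ i)))
        + 9 / 2 * B * (4 / 3) ^ i * Real.exp (-(t - 4 * N * ρ ^ i)))) * v0 := by
    intro m
    induction m with
    | zero =>
      intro i t ht
      refine (hv t (le_trans (by positivity) ht)).trans (le_mul_of_one_le_left hv0 ?_)
      have h : 0 ≤ Real.exp (-(2 * (t - 4 * N * ρ ^ i)))
        + 9 / 2 * B * (4 / 3) ^ i * Real.exp (-(t - 4 * N * ρ ^ i)) := by positivity
      simpa using h
    | succ m ih =>
      intro i t ht
      have hρi : 0 < ρ ^ i := by positivity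
      have hstep : 4 * N * ρ ^ (i + 1) = 4 * N * ρ ^ i - ρ ^ i := by
        rw [pow_succ, hρ]
        field_simp
      have h1 := ih (i + 1) (t - ρ ^ i) (by rw [hstep]; linarith)
      have he : ρ ^ i ≤ t := by
        have : 1 * ρ ^ i ≤ 4 * N * ρ ^ i := mul_le_mul_of_nonneg_right (by linarith) hρi.le
        linarith
      have h2 := hrec (ρ ^ i) t hρi (pow_le_one₀ hρ0.le hρ1) he
      rw [hstep, show t - ρ ^ i - (4 * N * ρ ^ i - ρ ^ i) = t - 4 * N * ρ ^ i by ring] at h1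
      have hτ : 0 ≤ 4 * N * ρ ^ i := by positivity
      have h3 : Real.exp (-(2 * t)) ≤ Real.exp (-(2 * (t - 4 * N * ρ ^ i))) :=
        Real.exp_le_exp.2 (by linarith)
      have h4 : Real.exp (-t) ≤ Real.exp (-(t - 4 * N * ρ ^ i)) :=
        Real.exp_le_exp.2 (by linarith)
      set X := Real.exp (-(2 * (t - 4 * N * ρ ^ i)))
      set Y := Real.exp (-(t - 4 * N * ρ ^ i))
      have h5 : B / (ρ ^ i) ^ N ≤ B * (4 / 3) ^ i := by
        rw [div_eq_mul_one_div]
        exact mul_le_mul_of_nonneg_left (hinv i) hB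
      have h6 : B / (ρ ^ i) ^ N * Real.exp (-t) ≤ B * (4 / 3) ^ i * Y :=
        mul_le_mul h5 h4 (Real.exp_pos _).le (by positivity)
      have h7 := mul_le_mul_of_nonneg_right
        (show Real.exp (-(2 * t)) + 3 * (B / (ρ ^ i) ^ N) * Real.exp (-t)
          ≤ X + 3 * (B * (4 / 3) ^ i * Y) by linarith) hv0
      -- The constant `9/2` is the fixed point of `κ ↦ (1/2)(4/3) κ + 3/2`.
      calc v t ≤ 1 / 2 * (((1 / 2) ^ m + (X + 9 / 2 * B * (4 / 3) ^ (i + 1) * Y)) * v0)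
            + 1 / 2 * ((X + 3 * (B * (4 / 3) ^ i * Y)) * v0) := by linarith
        _ = _ := by rw [pow_succ, pow_succ]; ring
  have hlim : Tendsto (fun m : ℕ => ((1 / 2 : ℝ) ^ m + (Real.exp (-(2 * (t - 4 * N * ρ ^ 0)))
        + 9 / 2 * B * (4 / 3) ^ 0 * Real.exp (-(t - 4 * N * ρ ^ 0)))) * v0) atTop
      (𝓝 ((0 + (Real.exp (-(2 * (t - 4 * N * ρ ^ 0)))
        + 9 / 2 * B * (4 / 3) ^ 0 * Real.exp (-(t - 4 * N * ρ ^ 0)))) * v0)) :=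
    ((tendsto_pow_atTop_nhds_zero_of_lt_one (by norm_num) (by norm_num)).add_const _).mul_const _
  have := ge_of_tendsto' hlim fun m => main m 0 t (by simpa using ht)
  simpa using this

/-- The squared distance at times of the order of the relaxation time and beyond. -/
theorem evol_sqDist_le {G : WeightedGraph V} {π : SiteWeights V} {a b w : ℝ} {N : ℕ}
    (hN0 : 0 < N) (ha : 0 < a) (hb : 0 < b) (hw : ∀ x, π.w x ≤ w) (hg : 0 < spectralGap G π)
    (hN : ∀ ζ, (sqDist π ζ + 1) ^ (1 + 1 / N : ℝ) ≤
      a / spectralGap G π * energy G π (edgeWeight π) ζ + b * (sqDist π ζ + 1))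
    (η : stdSimplex ℝ V) {t : ℝ} (ht : 4 * N + 1 ≤ t) :
    evol G π η (sqDist π) (t / spectralGap G π) ≤ (Real.exp (-(2 * (t - (4 * N + 1))))
      + 18 * Real.exp 2 * ((2 * b) ^ N + (2 * a * N) ^ N) * w * Real.exp (-(t - (4 * N + 1))))
        * ((2 * b) ^ N + (2 * a * N) ^ N) := by
  obtain ⟨l, f, h⟩ := exists_diagonalizes G π
  set g := spectralGap G π with hgdef
  set M := (2 * b) ^ N + (2 * a * N) ^ N with hM
  have hM0 : 0 ≤ M := by positivity
  have hw0 : 0 ≤ w := by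
    obtain ⟨x⟩ := G.connected.nonempty
    exact (π.pos x).le.trans (hw x)
  have hultra : ∀ e, 0 < e → e ≤ 1 → ∀ η, evol G π η (sqDist π) (e / g) ≤ M / e ^ N := by
    intro e he he1 η
    have h1 := evol_sqDist_le_of_nash hN0 (div_pos ha hg) hb hN η (div_pos he hg)
    have h2 : 2 * (a / g) * N / (e / g) = 2 * a * N / e := by field_simp
    rw [h2, div_pow] at h1
    have h3 : (2 * b) ^ N ≤ (2 * b) ^ N / e ^ N :=
      le_div_self (by positivity) (by positivity) (pow_le_one₀ he.le he1)
    rw [hM, add_div]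
    linarith
  have hclaim : ∀ η, ∀ s : ℝ, 4 * N ≤ s → evol G π η (sqDist π) (s / g) ≤
      (Real.exp (-(2 * (s - 4 * N))) + 9 / 2 * (4 * Real.exp 2 * M * w)
        * Real.exp (-(s - 4 * N))) * sqDist π η := by
    intro η s hs
    refine iterate_half (v := fun s => evol G π η (sqDist π) (s / g)) hN0 (by positivity)
      (sqDist_nonneg π η) (fun r hr => ?_) (fun e r he he1 her => ?_) hs
    · have := evol_sqDist_antitone G π η le_rfl (div_nonneg hr hg.le)
      rwa [evol_zero] at this
    -- In `β`, the factor `4 M / e ^ N` bounds the smoothed `edgeVec` at time `e / g`, `w` bounds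
    -- the edge weight, and `exp 2` pays for measuring the decay from `0` instead of `e / g`, as `e
    -- ≤ 1`.
    · have := h.evol_sqDist_le_half η (t := r / g) (ε := e / g)
        (β := 4 * Real.exp 2 * M * w / e ^ N) (by positivity)
        (div_le_div_of_nonneg_right her hg.le) (by positivity) hg.le (fun u hu x y => by
          refine (h.edgeWeight_mul_heatNorm_le (by positivity) hu hw (hultra e he he1) x y).trans ?_
          have h1 : Real.exp (-(2 * spectralGap G π * (u - e / g)))
              ≤ Real.exp 2 * Real.exp (-(2 * spectralGap G π * u)) := by
            rw [← Real.exp_add, Real.exp_le_exp, ← hgdef]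
            have : g * (e / g) = e := by field_simp
            nlinarith
          have h2 := mul_le_mul_of_nonneg_left h1
            (show 0 ≤ 4 * M * w / e ^ N by positivity)
          calc _ = 4 * M * w / e ^ N * Real.exp (-(2 * spectralGap G π * (u - e / g))) := by ring
            _ ≤ _ := h2
            _ = _ := by ring)
      rw [← sub_div, ← hgdef, show 2 * g * (r / g) = 2 * r by field_simp,
        show g * (r / g) = r by field_simp] at this
      exact this
  have hs : 4 * (N : ℝ) ≤ t - 1 := by linarith
  set K := Real.exp (-(2 * (t - 1 - 4 * N))) + 9 / 2 * (4 * Real.exp 2 * M * w)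
        * Real.exp (-(t - 1 - 4 * N)) with hK
  have hK0 : 0 ≤ K := by positivity
  -- The initial `sqDist` may be as large as `1 / π`. Restarting at time `1 / g` replaces it by its
  -- mean there, at most `M` by ultracontractivity.
  have h1 : evol G π η (sqDist π) (t / g) ≤ K * evol G π η (sqDist π) (1 / g) := by
    rw [show t / g = 1 / g + (t - 1) / g by ring, evol_add_time, ← evol_smul]
    exact evol_mono G π η (fun ζ => hclaim ζ (t - 1) hs) (by positivity)
  have h2 : evol G π η (sqDist π) (1 / g) ≤ M := by
    simpa using hultra 1 one_pos le_rfl η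
  refine (h1.trans (mul_le_mul_of_nonneg_left h2 hK0)).trans (le_of_eq ?_)
  rw [hK, show t - (4 * N + 1) = t - 1 - 4 * (N : ℝ) by ring]
  ring

/-! ### The expected distance -/

theorem norm_mono (π : SiteWeights V) {p q : ℝ} (hp : 0 < p) (hpq : p ≤ q) (ψ : V → ℝ) :
    π.norm p ψ ≤ π.norm q ψ := by
  have h := Real.arith_mean_le_rpow_mean Finset.univ π.w (fun x => |ψ x| ^ p)
    (fun x _ => (π.pos x).le) π.sum_eq_one (fun x _ => by positivity)
    (p := q / p) ((one_le_div hp).2 hpq)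
  have h1 : ∀ x, (|ψ x| ^ p) ^ (q / p) = |ψ x| ^ q := fun x => by
    rw [← Real.rpow_mul (abs_nonneg _), mul_div_cancel₀ _ hp.ne']
  simp only [h1] at h
  have hs : 0 ≤ ∑ x, π.w x * |ψ x| ^ p :=
    Finset.sum_nonneg fun x _ => mul_nonneg (π.pos x).le (by positivity)
  have hs' : 0 ≤ ∑ x, π.w x * |ψ x| ^ q :=
    Finset.sum_nonneg fun x _ => mul_nonneg (π.pos x).le (by positivity)
  have h2 := Real.rpow_le_rpow hs h (one_div_pos.2 hp).le
  rw [← Real.rpow_mul hs'] at h2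
  have h3 : 1 / (q / p) * (1 / p) = 1 / q := by
    field_simp
  rwa [h3] at h2

theorem norm_two (π : SiteWeights V) (ψ : V → ℝ) : π.norm 2 ψ = √(pairing π ψ ψ) := by
  rw [SiteWeights.norm, Real.sqrt_eq_rpow, pairing]
  congr 1
  refine Finset.sum_congr rfl fun x _ => ?_
  rw [Real.rpow_two, sq_abs, sq]

theorem norm_one_eq (π : SiteWeights V) (ψ : V → ℝ) : π.norm 1 ψ = ∑ x, π.w x * |ψ x| := by
  simp [SiteWeights.norm]

theorem SiteWeights.norm_nonneg (π : SiteWeights V) (p : ℝ) (ψ : V → ℝ) : 0 ≤ π.norm p ψ :=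
  Real.rpow_nonneg (Finset.sum_nonneg fun x _ => mul_nonneg (π.pos x).le (by positivity)) _

theorem continuous_norm_centered (π : SiteWeights V) {p : ℝ} (hp : 0 ≤ p) :
    Continuous fun ζ => π.norm p (centered π ζ) := by
  refine Continuous.rpow_const (continuous_finsetSum _ fun x _ => continuous_const.mul
    (Continuous.rpow_const (continuous_centered_apply π x).abs fun _ => Or.inr hp))
    fun _ => Or.inr (one_div_nonneg.2 hp)

/-- The `L^p` distance to equilibrium. -/
def distFun (π : SiteWeights V) (p : ℝ) (hp : 0 ≤ p) : C(stdSimplex ℝ V, ℝ) :=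
  ⟨fun ζ => π.norm p (centered π ζ), continuous_norm_centered π hp⟩

theorem expectedDist_eq (G : WeightedGraph V) (π : SiteWeights V) {p : ℝ} (hp : 0 ≤ p) (t : ℝ≥0)
    (η : stdSimplex ℝ V) :
    expectedDist G π p t η = ENNReal.ofReal (evol G π η (distFun π p hp) t) := by
  rw [← semigroup_eq_evol, ← integral_law, ofReal_integral_eq_lintegral_ofReal]
  · rfl
  · exact (distFun π p hp).continuous.integrable_of_hasCompactSupport
      (HasCompactSupport.of_compactSpace _)
  · exact ae_of_all _ fun ζ => SiteWeights.norm_nonneg π p _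

theorem evol_distFun_le (G : WeightedGraph V) (π : SiteWeights V) (η : stdSimplex ℝ V) {p : ℝ}
    (hp : 1 ≤ p) (hp2 : p ≤ 2) {t r : ℝ} (ht : 0 ≤ t) (hr : 0 < r)
    (h : evol G π η (sqDist π) t ≤ r ^ 2) :
    evol G π η (distFun π p (by linarith)) t ≤ r := by
  -- The bound `s ≤ s² / (2r) + r / 2` replaces Cauchy-Schwarz for the expectation.
  have h1 := evol_mono G π η (F := distFun π p (by linarith))
    (H := (1 / (2 * r)) • sqDist π + (r / 2) • 1) (fun ζ => by
      have h2 : distFun π p (by linarith) ζ ≤ √(sqDist π ζ) :=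
        (norm_mono π (by linarith) hp2 _).trans (norm_two π _).le
      have h3 := Real.sq_sqrt (sqDist_nonneg π ζ)
      simp only [ContinuousMap.add_apply, ContinuousMap.smul_apply, ContinuousMap.one_apply,
        smul_eq_mul]
      refine h2.trans ?_
      rw [← h3, Real.sqrt_sq (Real.sqrt_nonneg _)]
      set s := √(sqDist π ζ)
      have : 1 / (2 * r) * s ^ 2 + r / 2 * 1 - s = (s - r) ^ 2 / (2 * r) := by
        field_simp; ring
      have h5 : 0 ≤ (s - r) ^ 2 / (2 * r) := by positivity
      linarith) ht
  rw [evol_add, evol_smul, evol_smul, evol_one G π η ht] at h1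
  refine h1.trans ?_
  have h2 := mul_le_mul_of_nonneg_left h (show 0 ≤ 1 / (2 * r) by positivity)
  have h3 : 1 / (2 * r) * r ^ 2 = r / 2 := by field_simp
  linarith

theorem worstDist_le (G : WeightedGraph V) (π : SiteWeights V) {p : ℝ} (hp : 1 ≤ p)
    (hp2 : p ≤ 2) {t r : ℝ} (ht : 0 ≤ t) (hr : 0 < r)
    (h : ∀ η, evol G π η (sqDist π) t ≤ r ^ 2) :
    worstDist G π p t.toNNReal ≤ ENNReal.ofReal r := by
  refine iSup_le fun η => ?_
  rw [expectedDist_eq G π (by linarith), Real.coe_toNNReal t ht]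
  exact ENNReal.ofReal_le_ofReal (evol_distFun_le G π η hp hp2 ht hr (h η))

/-! ### The lower bound -/

/-- The sign is chosen so that the maximum of `|f|` is attained with `f z > 0`; the process will
start from the point mass at `z`. -/
theorem exists_gap_eigenfunction (G : WeightedGraph V) (π : SiteWeights V)
    (hV : 1 < Fintype.card V) :
    ∃ (f : V → ℝ) (z : V), singleGenerator G π f = -spectralGap G π • f ∧ MeanZero π f ∧
      0 < f z ∧ ∀ x, |f x| ≤ f z := by
  obtain ⟨l, f, h⟩ := exists_diagonalizes G π
  obtain ⟨i, hi, he⟩ := h.exists_eigenvalue_eq_spectralGap hV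
  have hm := h.meanZero_of_eigenvalue_ne_zero hi
  have hf := h.eigen i
  rw [he] at hf
  have : Nonempty V := G.connected.nonempty
  obtain ⟨z, hz⟩ := Finite.exists_max fun x => |f i x|
  have hz0 : f i z ≠ 0 := by
    intro h0
    have hf0 : f i = 0 := by
      funext x
      have := hz x
      rw [h0, abs_zero] at this
      exact abs_eq_zero.1 (le_antisymm this (abs_nonneg _))
    have := h.norm_one i
    simp [hf0, pairing] at this
  rcases lt_or_gt_of_ne hz0 with hneg | hpos
  · refine ⟨-f i, z, ?_, ?_, by simpa using hneg, fun x => ?_⟩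
    · have := (singleGeneratorLin G π).map_neg (f i)
      change singleGenerator G π (-f i) = -singleGenerator G π (f i) at this
      rw [this, hf, smul_neg]
    · simpa [MeanZero] using hm
    · simpa [abs_of_neg hneg] using hz x
  · exact ⟨f i, z, hf, hm, hpos, fun x => (hz x).trans_eq (abs_of_pos hpos)⟩

theorem generator_coordFun_eigen {G : WeightedGraph V} {π : SiteWeights V} {f : V → ℝ} {g : ℝ}
    (hf : singleGenerator G π f = -g • f) :
    generator G π (coordFun π f) = (-g) • coordFun π f := by
  ext ζ
  rw [generator_coordFun, pairing_singleGenerator_comm, hf, pairing_comm, pairing_smul_left,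
    pairing_comm]
  rfl

/-- Since `coordFun π f` is an eigenfunction of the generator, its mean is exactly `e^{-gt} f z`. By
duality between `L¹` and `L^∞` it is at most `f z` times the mean `L¹` distance. -/
theorem exp_le_evol_distFun (G : WeightedGraph V) (π : SiteWeights V) (hV : 1 < Fintype.card V)
    {p : ℝ} (hp : 1 ≤ p) {t : ℝ} (ht : 0 ≤ t) :
    ∃ η, Real.exp (-(spectralGap G π * t)) ≤ evol G π η (distFun π p (by linarith)) t := by
  classical
  obtain ⟨f, z, hf, hm, hz0, hz⟩ := exists_gap_eigenfunction G π hV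
  set g := spectralGap G π
  refine ⟨⟨Pi.single z 1, single_mem_stdSimplex ℝ z⟩, ?_⟩
  set η : stdSimplex ℝ V := ⟨Pi.single z 1, single_mem_stdSimplex ℝ z⟩ with hη
  have hstart : coordFun π f η = f z := by
    have h1 : ∀ x, π.w x * (centered π η x * f x) = (Pi.single z 1 : V → ℝ) x * f x
        - π.w x * f x := fun x => by
      have := (π.pos x).ne'
      change π.w x * (((Pi.single z 1 : V → ℝ) x / π.w x - 1) * f x) = _
      field_simp
    change pairing π (centered π η) f = f z
    unfold MeanZero at hm
    simp only [pairing, h1, Finset.sum_sub_distrib, hm, sub_zero]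
    simp [Pi.single_apply]
  have hd : ∀ r, HasDerivAt (fun r => Real.exp (g * r) * evol G π η (coordFun π f) r) 0 r :=
    fun r => by
      have h1 : HasDerivAt (fun r => Real.exp (g * r)) (Real.exp (g * r) * g) r := by
        simpa using ((hasDerivAt_id r).const_mul g).exp
      have h2 := h1.mul (hasDerivAt_evol G π η (coordFun π f) r)
      rw [generator_coordFun_eigen hf, evol_smul] at h2
      convert! h2 using 1
      ring
  have h3 := le_of_hasDerivAt_nonneg ht hd fun _ _ _ => le_rfl
  simp only [mul_zero, Real.exp_zero, one_mul, evol_zero, hstart] at h3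
  have h4 := evol_mono G π η (F := coordFun π f) (H := f z • distFun π p (by linarith))
    (fun ζ => by
      have h5 : distFun π 1 zero_le_one ζ ≤ distFun π p (by linarith) ζ :=
        norm_mono π one_pos hp _
      refine le_trans ?_ (mul_le_mul_of_nonneg_left h5 hz0.le)
      change pairing π (centered π ζ) f ≤ f z * π.norm 1 (centered π ζ)
      rw [norm_one_eq, Finset.mul_sum, pairing]
      refine Finset.sum_le_sum fun x _ => ?_
      have h6 : centered π ζ x * f x ≤ f z * |centered π ζ x| := by
        refine (le_abs_self _).trans ?_
        rw [abs_mul, mul_comm]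
        exact mul_le_mul_of_nonneg_right (hz x) (abs_nonneg _)
      nlinarith [π.pos x]) ht
  rw [evol_smul] at h4
  rw [Real.exp_neg, inv_le_iff_one_le_mul₀' (Real.exp_pos _)]
  have h5 := h3.trans (mul_le_mul_of_nonneg_left h4 (Real.exp_pos (g * t)).le)
  nlinarith

theorem ofReal_exp_le_worstDist (G : WeightedGraph V) (π : SiteWeights V)
    (hV : 1 < Fintype.card V) {p : ℝ} (hp : 1 ≤ p) {t : ℝ} (ht : 0 ≤ t) :
    ENNReal.ofReal (Real.exp (-(spectralGap G π * t))) ≤ worstDist G π p t.toNNReal := by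
  obtain ⟨η, hη⟩ := exp_le_evol_distFun G π hV hp ht
  refine le_trans ?_ (le_iSup _ η)
  rw [expectedDist_eq G π (by linarith), Real.coe_toNNReal t ht]
  exact ENNReal.ofReal_le_ofReal hη

/-! ### Consequences of the assumptions -/

theorem nash_sqDist {G : WeightedGraph V} {π : SiteWeights V} {d tNash T a b : ℝ} {N : ℕ}
    (hN0 : 0 < N) (hd : 0 < d) (hdN : d ≤ N) (hT : 0 < T)
    (hNash : NashInequality G π d tNash T) (ha : tNash ≤ a) (hb : tNash ≤ b * T)
    (ζ : stdSimplex ℝ V) :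
    (sqDist π ζ + 1) ^ (1 + 1 / N : ℝ) ≤
      a * energy G π (edgeWeight π) ζ + b * (sqDist π ζ + 1) := by
  have hNpos : (0 : ℝ) < N := Nat.cast_pos.2 hN0
  -- The Nash inequality is applied to the density `ζ/π`, whose `L¹` norm is `1`.
  set ψ : V → ℝ := fun x => centered π ζ x + 1 with hψ
  have hψ' : ∀ x, ψ x = ζ.1 x / π.w x := fun x => sub_add_cancel _ _
  have h1 : π.norm 1 ψ = 1 := by
    rw [norm_one_eq, ← ζ.2.2]
    refine Finset.sum_congr rfl fun x _ => ?_
    have := π.pos x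
    rw [hψ', abs_of_nonneg (div_nonneg (ζ.2.1 x) this.le)]
    field_simp
  have h2 : pairing π ψ ψ = sqDist π ζ + 1 := by
    have hm := meanZero_centered π ζ
    unfold MeanZero at hm
    have h3 : ∀ x, π.w x * (ψ x * ψ x) = π.w x * (centered π ζ x * centered π ζ x)
        + 2 * (π.w x * centered π ζ x) + π.w x := fun x => by simp only [hψ]; ring
    simp only [pairing, h3, Finset.sum_add_distrib, ← Finset.mul_sum, hm, π.sum_eq_one]
    rw [mul_zero, add_zero]
    rfl
  have hX : 1 ≤ sqDist π ζ + 1 := by linarith [sqDist_nonneg π ζ]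
  have h3 := hNash ψ
  set X := sqDist π ζ + 1
  set D := energy G π (edgeWeight π) ζ with hD
  have hD0 : 0 ≤ D := energy_edgeWeight_nonneg G π ζ
  have h4 : dirichletForm G π ψ = D := dirichletForm_const_add G π _ 1
  rw [h1, h4, norm_two, h2, Real.one_rpow, mul_one, Real.rpow_mul (Real.sqrt_nonneg _),
    Real.rpow_two, Real.sq_sqrt (by linarith)] at h3
  -- As `1 ≤ X`, the exponent `1 + 2/d` may be lowered to `1 + 1/N`, with an integer `N` common to
  -- all the graphs.
  have h5 : (1 : ℝ) / N ≤ 2 / d := by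
    rw [div_le_div_iff₀ hNpos hd]; linarith
  refine ((Real.rpow_le_rpow_of_exponent_le hX (by linarith)).trans h3).trans ?_
  have h6 : tNash * T⁻¹ ≤ b := by
    rwa [← div_eq_mul_inv, div_le_iff₀ hT]
  have h7 := mul_le_mul_of_nonneg_right ha hD0
  have h8 := mul_le_mul_of_nonneg_right h6 (show 0 ≤ X by linarith)
  calc tNash * (D + T⁻¹ * X) = tNash * D + tNash * T⁻¹ * X := by ring
    _ ≤ _ := add_le_add h7 h8

/-- The maximum is at most `c` times the minimum, and the minimum is at most the average `1/n`. -/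
theorem weight_le_of_elliptic [Nonempty V] (π : SiteWeights V) {c : ℝ}
    (h : (⨆ x, π.w x) / (⨅ y, π.w y) ≤ c) (x : V) : π.w x ≤ c / Fintype.card V := by
  have hn : (0 : ℝ) < Fintype.card V := Nat.cast_pos.2 Fintype.card_pos
  obtain ⟨y, hy⟩ := Finite.exists_min π.w
  have hinf : (⨅ y, π.w y) = π.w y := le_antisymm (ciInf_le (Finite.bddBelow_range _) y) (le_ciInf hy)
  rw [hinf, div_le_iff₀ (π.pos y)] at h
  have hx := (le_ciSup (Finite.bddAbove_range π.w) x).trans h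
  have hc : 0 ≤ c := by
    by_contra hc
    nlinarith [π.pos x, π.pos y]
  have hsum : (Fintype.card V : ℝ) * π.w y ≤ 1 := by
    rw [← π.sum_eq_one]
    simpa using Finset.card_nsmul_le_sum Finset.univ π.w (π.w y) fun x _ => hy x
  rw [le_div_iff₀ hn]
  nlinarith

theorem log_bounds {n k : ℕ} (hn : 1 < n) (hk : n ^ 2 ≤ k) :
    0 < Real.log n ∧ 2 * Real.log n ≤ Real.log k ∧
      Real.log ((k : ℝ) / n) = Real.log k - Real.log n := by
  have hn' : (1 : ℝ) < n := by exact_mod_cast hn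
  have hk' : (n : ℝ) ^ 2 ≤ k := by exact_mod_cast hk
  have hk0 : (0 : ℝ) < k := lt_of_lt_of_le (by positivity) hk'
  refine ⟨Real.log_pos hn', ?_, Real.log_div hk0.ne' (by linarith)⟩
  have := Real.log_le_log (by positivity) hk'
  rwa [Real.log_pow, Nat.cast_two] at this

theorem preCutoffFactor_mem {n k : ℕ} (hn : 1 < n) (hk : n ^ 2 ≤ k) :
    preCutoffFactor n k ∈ Set.Icc (1 : ℝ) 2 := by
  obtain ⟨h1, h2, h3⟩ := log_bounds hn hk
  have hpos : 0 < Real.log k := by linarith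
  rw [preCutoffFactor, h3, ← mul_div_assoc]
  constructor
  · rw [le_div_iff₀ hpos]; linarith
  · rw [div_le_iff₀ hpos]; linarith

theorem timePlus_eq {n k : ℕ} (hn : 1 < n) (hk : n ^ 2 ≤ k) (g C : ℝ) :
    timePlus g⁻¹ C n k = (Real.log ((k : ℝ) / n) + C) / g := by
  obtain ⟨h1, h2, -⟩ := log_bounds hn hk
  have hpos : Real.log k ≠ 0 := by linarith
  rw [timePlus, preCutoffFactor]
  field_simp

theorem upper_bound {G : WeightedGraph V} {π : SiteWeights V} {a b c δ C p : ℝ} {N k : ℕ}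
    (hV : 1 < Fintype.card V) (hN0 : 0 < N) (ha : 0 < a) (hb : 0 < b) (hc : 0 ≤ c)
    (hw : ∀ x, π.w x ≤ c / Fintype.card V)
    (hN : ∀ ζ, (sqDist π ζ + 1) ^ (1 + 1 / N : ℝ) ≤
      a / spectralGap G π * energy G π (edgeWeight π) ζ + b * (sqDist π ζ + 1))
    (hk : Fintype.card V ^ 2 ≤ k) (hδ : 0 < δ) (hC1 : 4 * N + 1 ≤ C)
    (hC2 : (Real.exp (2 * (4 * N + 1)) + 18 * Real.exp 2 * ((2 * b) ^ N + (2 * a * N) ^ N) * c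
      * Real.exp (4 * N + 1)) * ((2 * b) ^ N + (2 * a * N) ^ N) ≤ Real.exp C * δ ^ 2)
    (hp : p ∈ Set.Icc (1 : ℝ) 2) :
    ENNReal.ofReal √k * worstDist G π p
      (timePlus (relaxationTime G π) C (Fintype.card V) k).toNNReal ≤ ENNReal.ofReal δ := by
  have hg := spectralGap_pos G π hV
  obtain ⟨h1, h2, h3⟩ := log_bounds hV hk
  set n := Fintype.card V
  have hn' : (1 : ℝ) < n := by exact_mod_cast hV
  have hk' : (n : ℝ) ^ 2 ≤ k := by exact_mod_cast hk
  have hn0 : (0 : ℝ) < n := by linarith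
  have hk0 : (0 : ℝ) < k := lt_of_lt_of_le (by positivity) hk'
  have hNn : (0 : ℝ) ≤ N := Nat.cast_nonneg N
  have hsk : 0 < √(k : ℝ) := Real.sqrt_pos.2 hk0
  rw [relaxationTime, timePlus_eq hV hk]
  set t := Real.log ((k : ℝ) / n) + C with ht
  have ht1 : 4 * N + 1 ≤ t := by linarith
  have key : ∀ η, evol G π η (sqDist π) (t / spectralGap G π) ≤ (δ / √k) ^ 2 := by
    intro η
    refine (evol_sqDist_le hN0 ha hb hw hg hN η ht1).trans ?_
    set M := (2 * b) ^ N + (2 * a * N) ^ N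
    have hM : 0 ≤ M := by positivity
    set E := Real.exp (4 * N + 1) with hE
    set e := Real.exp (-C) with he
    have hEpos : 0 < E := Real.exp_pos _
    have hepos : 0 < e := Real.exp_pos _
    have he1 : e ≤ 1 := Real.exp_le_one_iff.2 (by linarith)
    have h4 : Real.exp (-(t - (4 * N + 1))) = n / k * (e * E) := by
      rw [show -(t - (4 * (N : ℝ) + 1)) = -Real.log ((k : ℝ) / n) + (-C + (4 * N + 1)) by
        rw [ht]; ring, Real.exp_add, Real.exp_add, Real.exp_neg,
        Real.exp_log (by positivity), inv_div]
    have h5 : ∀ s, Real.exp (2 * s) = Real.exp s ^ 2 := fun s => by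
      rw [← Real.exp_nat_mul, Nat.cast_two]
    -- The mean contributes `(n/k)²`, which is at most `1/k` because `n² ≤ k`.
    have h6 : Real.exp (-(2 * (t - (4 * N + 1)))) ≤ 1 / k * (e * E ^ 2) := by
      rw [← mul_neg, h5, h4]
      have : ((n : ℝ) / k * (e * E)) ^ 2 = 1 / k * (e * E ^ 2) * ((n : ℝ) ^ 2 / k) * e := by
        field_simp
      rw [this]
      have h7 : (n : ℝ) ^ 2 / k ≤ 1 := (div_le_one hk0).2 hk'
      have h8 : (0 : ℝ) ≤ 1 / k * (e * E ^ 2) := by positivity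
      exact (mul_le_mul (mul_le_of_le_one_right h8 h7) he1 hepos.le h8).trans_eq (mul_one _)
    rw [h5, ← hE] at hC2
    have hC3 : e * ((E ^ 2 + 18 * Real.exp 2 * M * c * E) * M) ≤ δ ^ 2 := by
      rw [he, Real.exp_neg, inv_mul_le_iff₀ (Real.exp_pos _)]
      exact hC2
    rw [h4, div_pow, Real.sq_sqrt hk0.le]
    calc _ ≤ (1 / k * (e * E ^ 2) + 18 * Real.exp 2 * M * (c / n) * (n / k * (e * E))) * M :=
          mul_le_mul_of_nonneg_right (add_le_add_left h6 _) hM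
      -- In the noise term, the weight bound `c/n` cancels the `n` of `n/k`.
      _ = e * ((E ^ 2 + 18 * Real.exp 2 * M * c * E) * M) / k := by field_simp
      _ ≤ δ ^ 2 / k := div_le_div_of_nonneg_right hC3 hk0.le
  have hw := worstDist_le G π hp.1 hp.2 (t := t / spectralGap G π)
    (div_nonneg (by linarith) hg.le) (div_pos hδ hsk) key
  refine (mul_le_mul_right hw _).trans (le_of_eq ?_)
  rw [← ENNReal.ofReal_mul hsk.le, mul_div_cancel₀ _ hsk.ne']

theorem timeMinus_eq (g C : ℝ) (k : ℕ) :
    timeMinus g⁻¹ C k = (Real.log k / 2 - C) / g := by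
  rw [timeMinus]; ring

theorem lower_bound {G : WeightedGraph V} {π : SiteWeights V} {δ C p : ℝ} {k : ℕ}
    (hV : 1 < Fintype.card V) (hk : 0 < k) (hC : 1 / δ ≤ Real.exp C)
    (ht : 0 ≤ timeMinus (relaxationTime G π) C k) (hp : p ∈ Set.Icc (1 : ℝ) 2) :
    ENNReal.ofReal (1 / δ) ≤ ENNReal.ofReal √k * worstDist G π p
      (timeMinus (relaxationTime G π) C k).toNNReal := by
  have hg := spectralGap_pos G π hV
  have hk0 : (0 : ℝ) < k := Nat.cast_pos.2 hk
  refine le_trans ?_ (mul_le_mul_right (ofReal_exp_le_worstDist G π hV hp.1 ht) _)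
  rw [← ENNReal.ofReal_mul (Real.sqrt_nonneg _)]
  refine ENNReal.ofReal_le_ofReal (hC.trans (le_of_eq ?_))
  rw [relaxationTime, timeMinus_eq, mul_div_cancel₀ _ hg.ne', neg_sub, Real.exp_sub,
    Real.exp_half, Real.exp_log hk0]
  field_simp

end

end Averaging

/-! ### Choice of the constant and passage to the limit -/

theorem mainTheorem8 {V : ℕ → Type*} [∀ j, Fintype (V j)]
    (G : ∀ j, Averaging.WeightedGraph (V j)) (π : ∀ j, Averaging.SiteWeights (V j))
    (hcard : Tendsto (fun j => Fintype.card (V j)) atTop atTop)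
    (hNash : Averaging.FiniteDimensional G π) (hEll : Averaging.UniformlyElliptic π)
    (δ : ℝ) (hδ : δ ∈ Set.Ioo (0 : ℝ) 1) :
    ∃ C : ℝ, 0 < C ∧ ∀ k : ℕ → ℕ,
      Tendsto (fun j => (k j : ℝ) / (Fintype.card (V j) : ℝ) ^ 2) atTop atTop →
      (∀ᶠ j in atTop, Averaging.preCutoffFactor (Fintype.card (V j)) (k j) ∈ Set.Icc (1 : ℝ) 2) ∧
      (∀ᶠ j in atTop,
        0 ≤ Averaging.timePlus (Averaging.relaxationTime (G j) (π j)) C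
          (Fintype.card (V j)) (k j) ∧
        0 ≤ Averaging.timeMinus (Averaging.relaxationTime (G j) (π j)) C (k j)) ∧
      ∀ p ∈ Set.Icc (1 : ℝ) 2,
        limsup (fun j => ENNReal.ofReal (Real.sqrt (k j)) *
          Averaging.worstDist (G j) (π j) p
            (Averaging.timePlus (Averaging.relaxationTime (G j) (π j)) C
              (Fintype.card (V j)) (k j)).toNNReal) atTop ≤ ENNReal.ofReal δ ∧
        ENNReal.ofReal (1 / δ) ≤
          liminf (fun j => ENNReal.ofReal (Real.sqrt (k j)) *
            Averaging.worstDist (G j) (π j) p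
              (Averaging.timeMinus (Averaging.relaxationTime (G j) (π j)) C (k j)).toNNReal)
            atTop := by
  obtain ⟨d, tN, T, hpos, hNash, hdO, htO, hTΘ⟩ := hNash
  obtain ⟨c, hc1, hc⟩ := hEll
  obtain ⟨D, hD0, hD⟩ := hdO.exists_pos
  obtain ⟨a, ha0, ha⟩ := htO.exists_pos
  obtain ⟨b, hb0, hb⟩ := hTΘ.2.exists_pos
  obtain ⟨N, hN⟩ := exists_nat_ge (max D 1)
  have hN0 : 0 < N := by
    have := (le_max_right D 1).trans hN
    exact_mod_cast this
  have hδ0 := hδ.1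
  set Q := (Real.exp (2 * (4 * N + 1)) + 18 * Real.exp 2 * ((2 * b) ^ N + (2 * a * N) ^ N) * c
    * Real.exp (4 * N + 1)) * ((2 * b) ^ N + (2 * a * N) ^ N) with hQ
  have hQ0 : 0 ≤ Q := by positivity
  -- With `C = log R`, the three summands give `hC2` (upper bound), `hC3` (lower bound) and `hC1`
  -- (enough time to iterate). None of them involves `k`.
  set R := Q / δ ^ 2 + 1 / δ + Real.exp (4 * N + 1) with hR
  have hR1 : 0 ≤ Q / δ ^ 2 := by positivity
  have hR2 : 0 < 1 / δ := by positivity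
  have hR3 := Real.exp_pos (4 * N + 1)
  have hR0 : 0 < R := by positivity
  have hexp : Real.exp (Real.log R) = R := Real.exp_log hR0
  have hC1 : 4 * (N : ℝ) + 1 ≤ Real.log R := by
    rw [Real.le_log_iff_exp_le hR0]; linarith
  have hC2 : Q ≤ Real.exp (Real.log R) * δ ^ 2 := by
    rw [hexp, ← div_le_iff₀ (by positivity)]; linarith
  have hC3 : 1 / δ ≤ Real.exp (Real.log R) := by rw [hexp]; linarith
  have hC0 : 0 < Real.log R := lt_of_lt_of_le (by positivity) hC1
  refine ⟨Real.log R, hC0, fun k hk => ?_⟩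
  have hV : ∀ᶠ j in atTop, 1 < Fintype.card (V j) := hcard.eventually_gt_atTop 1
  have hkn : ∀ᶠ j in atTop, Fintype.card (V j) ^ 2 ≤ k j := by
    filter_upwards [hV, hk.eventually_ge_atTop 1] with j hVj hj
    have hn : (0 : ℝ) < Fintype.card (V j) := by exact_mod_cast one_pos.trans hVj
    rw [le_div_iff₀ (by positivity), one_mul] at hj
    exact_mod_cast hj
  have hklog : ∀ᶠ j in atTop, 2 * Real.log R ≤ Real.log (k j) := by
    have hktop : Tendsto (fun j => (k j : ℝ)) atTop atTop :=
      tendsto_atTop_mono' _ (by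
        filter_upwards [hV, hkn] with j hVj hj
        exact Nat.cast_le.2 ((Nat.le_self_pow two_ne_zero _).trans hj))
        (tendsto_natCast_atTop_atTop.comp hcard)
    exact (Real.tendsto_log_atTop.comp hktop).eventually_ge_atTop _
  have hminus : ∀ᶠ j in atTop,
      0 ≤ Averaging.timeMinus (Averaging.relaxationTime (G j) (π j)) (Real.log R) (k j) := by
    filter_upwards [hV, hklog] with j hVj hj
    rw [Averaging.relaxationTime, Averaging.timeMinus_eq]
    exact div_nonneg (by linarith) (Averaging.spectralGap_pos _ _ hVj).le
  refine ⟨?_, ?_, fun p hp => ⟨?_, ?_⟩⟩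
  · filter_upwards [hV, hkn] with j hVj hj using Averaging.preCutoffFactor_mem hVj hj
  · filter_upwards [hV, hkn, hminus] with j hVj hj hm
    refine ⟨?_, hm⟩
    obtain ⟨h1, h2, h3⟩ := Averaging.log_bounds hVj hj
    rw [Averaging.relaxationTime, Averaging.timePlus_eq hVj hj]
    exact div_nonneg (by linarith) (Averaging.spectralGap_pos _ _ hVj).le
  · refine limsup_le_of_le (h := ?_)
    filter_upwards [hV, hkn, hD.bound, ha.bound, hb.bound] with j hVj hj hDj haj hbj
    obtain ⟨hd0, ht0, hT0⟩ := hpos j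
    have hg := Averaging.spectralGap_pos (G j) (π j) hVj
    have : Nonempty (V j) := (G j).connected.nonempty
    rw [Real.norm_of_nonneg hd0.le, norm_one, mul_one] at hDj
    rw [Real.norm_of_nonneg ht0.le, Averaging.relaxationTime,
      Real.norm_of_nonneg (inv_nonneg.2 hg.le), ← div_eq_mul_inv] at haj
    rw [Real.norm_of_nonneg ht0.le, Real.norm_of_nonneg hT0.le] at hbj
    exact Averaging.upper_bound hVj hN0 ha0 hb0 (by linarith)
      (Averaging.weight_le_of_elliptic (π j) (hc j))
      (Averaging.nash_sqDist hN0 hd0 (hDj.trans ((le_max_left D 1).trans hN)) hT0 (hNash j)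
        haj hbj) hj hδ0 hC1 hC2 hp
  · refine le_liminf_of_le (h := ?_)
    filter_upwards [hV, hkn, hminus] with j hVj hj hm
    exact Averaging.lower_bound hVj (lt_of_lt_of_le (by positivity) hj) hC3 hm hp
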